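/- **Setting.** Let $C$ be an algebraically closed field of characteristic zero, and let $C(x)[D]$ be the ring of linear differential operators with coefficients in $C(x)$ (with $Dx=xD+1$), acting on $C((x))$ and on every differential ring containing $C(x)$. For $L\in C(x)[D]$ let $V(L)\subseteq C((x))$ be its $C$-space of solutions in $C((x))$. For a $C$-subspace $V$ and a subset $U$ of $C((x))$ put $(V:U)=\{h\in C((x)) : hU\subseteq V\}$. A nonzero operator is *primitive* if its coefficients are coprime polynomials in $C[x]$ and its leading coefficient is monic. $P$ is a *right factor* of $M$ if $M=RP$ for some $R\in C(x)[D]$. The *symmetric product* $L_1\otimes L_2$ of nonzero operators is the primitive operator of lowest order that annihilates $fg$ whenever $f,g$ lie in a differential ring extension of $C(x)$ and $L_1\cdot f=0$, $L_2\cdot g=0$; $L^{\otimes s}$ is the $s$-fold symmetric product, with $L^{\otimes 0}=D$. The point $0$ is *ordinary* for $L=\ell_0+\dots+\ell_rD^r$ ($\ell_r\ne0$) if it is not a pole of any $\ell_i/\ell_r$. The indicial polynomial of $N$ at $0$ is the nonzero $p\in C[s]$ such that, for some $\sigma\in\mathbb Z$, $N\cdot x^s=p(s)x^{s+\sigma}+O(x^{s+\sigma+1})$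 for all $s\in\mathbb N$; $Z_N$ is the set of its roots in $\mathbb N$. $T_k$ denotes truncation of a series after the term $x^k$. Let $L,M\in C(x)[D]$ have positive order, with $0$ an ordinary point of both. The *global quasi-symmetric quotient* of $M$ by $L$ is the primitive $Q$ of maximal order such that $L\otimes Q$ is a right factor of $M$. A *local quasi-symmetric quotient* of $M$ by $L$ at $0$ is a primitive operator $Q$ with $V(Q)=(V(M):V(L))$ such that $L\otimes Q$ is a right factor of $M$. **Algorithm** QuasiSymmetricQuotientAtZero$(M,L)$: 1. Set $r:=\operatorname{ord}(L)$ and $\delta:=$ ColonSpaceDimension$(M,L)$. If $\delta=0$, return $Q:=1$. 2. Otherwise set $k:=k_0+1$ with $k_0:=\max Z_N-\frac{r(r-1)}2$ and $N=M\otimes L^{\otimes(r-1)}$, and $d_0:=$ BoundDegreeOfQuasiSymmetricQuotientCoeffs$(M,L,\delta)$. 3. Repeat: (a) $\{h_1,\dots,h_\delta\}:=$ ColonSpaceBasis$(M,L,k)$; $d:=\min\{d_0,\lfloor (k-\delta)/(\delta+1)\rfloor\}$; $Q:=$ ApproximantAnnihilator$(h_1,\dots,h_\delta;d,\dots,d;k)$.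 (b) If $Q=\emptyset$ and $k\ge(\delta+1)(d_0+1)+\delta$, return None. (c) If $Q\neq\emptyset$, $\operatorname{ord}(Q)=\delta$ and $L\otimes Q$ is a right factor of $M$, return $Q$. (d) $k:=2k$. The subroutines may be any procedures meeting these specifications: ColonSpaceDimension returns $\dim_C(V(M):V(L))$; ColonSpaceBasis returns a $C$-basis $h_1,\dots,h_\delta$ of $T_k\big((V(M):V(L))\big)$; BoundDegreeOfQuasiSymmetricQuotientCoeffs returns an integer $d_0\ge 0$ that bounds the degrees of the coefficients of an order-$\delta$ global quasi-symmetric quotient of $M$ by $L$ (any $d_0$ is allowed if there is none); ApproximantAnnihilator returns a primitive operator $Q=q_0+\dots+q_\delta D^\delta$ with $q_i\in C[x]$, $\deg q_i\le d$ and $Q\cdot h_j=O(x^{k-\delta})$ for all $j$, or $\emptyset$ if there is no such operator. **Theorem.** For all $L,M$ as above, the algorithm terminates and is correct, whichever outputs allowed by the specifications the subroutines produce. That is: there is no infinite run; a run that has not yet returned can always be continued (in particular, whenever a quantity is computed or a subroutine is called, an admissible value exists); every operator $Q$ returned is a local quasi-symmetric quotient of $M$ by $L$ at $0$; and the answer is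 None if and only if no local quasi-symmetric quotient of $M$ by $L$ at $0$ exists. -/

import Mathlib

universe u

open scoped RatFunc Differential Polynomial

noncomputable section

/-! ### The differential fields `C(x)` and `C((x))` -/

namespace SymDiv

/-- An additive map satisfying the product rule makes a commutative ring a differential ring. -/
@[reducible] def mkDifferential {R : Type u} [CommRing R] (d : R →+ R)
    (h : ∀ a b, d (a * b) = a * d b + b * d a) : Differential R where
  deriv := Derivation.mk' d.toIntLinearMap h

theorem deriv_div_eq {R : Type u} [Field R] [Differential R] (a b : R) :
    (a / b)′ = b⁻¹ ^ 2 * (b * a′ - a * b′) := by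
  simpa using Derivation.leibniz_div (Differential.deriv (R := R)) a b

section RatFuncDeriv

variable {C : Type u} [Field C]

/-- The usual derivative of a rational function: `(p / q)' = (p' q - p q') / q²`. -/
def ratFuncDeriv (f : RatFunc C) : RatFunc C :=
  algebraMap C[X] (RatFunc C)
      (Polynomial.derivative f.num * f.denom - f.num * Polynomial.derivative f.denom) /
    algebraMap C[X] (RatFunc C) (f.denom ^ 2)

theorem ratFuncDeriv_div (p q : C[X]) (hq : q ≠ 0) :
    ratFuncDeriv (algebraMap C[X] (RatFunc C) p / algebraMap C[X] (RatFunc C) q) =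
      algebraMap C[X] (RatFunc C)
          (Polynomial.derivative p * q - p * Polynomial.derivative q) /
        algebraMap C[X] (RatFunc C) (q ^ 2) := by
  set f : RatFunc C := algebraMap C[X] (RatFunc C) p / algebraMap C[X] (RatFunc C) q with hf
  have hd : f.denom ≠ 0 := RatFunc.denom_ne_zero f
  have hcross : f.num * q = p * f.denom := (RatFunc.num_mul_eq_mul_denom_iff hq).mpr hf
  have hcross' : Polynomial.derivative f.num * q + f.num * Polynomial.derivative q =
      Polynomial.derivative p * f.denom + p * Polynomial.derivative f.denom := by
    have := congrArg Polynomial.derivative hcross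
    simpa [Polynomial.derivative_mul] using this
  unfold ratFuncDeriv
  rw [div_eq_div_iff (RatFunc.algebraMap_ne_zero (pow_ne_zero 2 hd))
    (RatFunc.algebraMap_ne_zero (pow_ne_zero 2 hq)), ← map_mul, ← map_mul]
  congr 1
  linear_combination (f.denom * q) * hcross' - (Polynomial.derivative f.denom * q +
    f.denom * Polynomial.derivative q) * hcross

/-- `C(x)` as a differential field. -/
instance ratFuncDifferential : Differential (RatFunc C) :=
  mkDifferential
      { toFun := ratFuncDeriv
        map_zero' := by
          have := ratFuncDeriv_div (C := C) 0 1 one_ne_zero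
          simpa using this
        map_add' := by
          intro a b
          induction a using RatFunc.induction_on with
          | f p q hq =>
          induction b using RatFunc.induction_on with
          | f p' q' hq' =>
          have h1 := RatFunc.algebraMap_ne_zero hq
          have h2 := RatFunc.algebraMap_ne_zero hq'
          rw [div_add_div _ _ h1 h2, ← map_mul, ← map_mul, ← map_mul, ← map_add,
            ratFuncDeriv_div _ _ hq, ratFuncDeriv_div _ _ hq',
            ratFuncDeriv_div _ _ (mul_ne_zero hq hq')]
          simp only [Polynomial.derivative_mul, map_sub, map_mul, map_add, map_pow]
          field_simp
          ring }
    (by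
      intro a b
      induction a using RatFunc.induction_on with
      | f p q hq =>
      induction b using RatFunc.induction_on with
      | f p' q' hq' =>
      have h1 := RatFunc.algebraMap_ne_zero hq
      have h2 := RatFunc.algebraMap_ne_zero hq'
      simp only [AddMonoidHom.coe_mk, ZeroHom.coe_mk]
      rw [div_mul_div_comm, ← map_mul, ← map_mul,
        ratFuncDeriv_div _ _ hq, ratFuncDeriv_div _ _ hq',
        ratFuncDeriv_div _ _ (mul_ne_zero hq hq')]
      simp only [Polynomial.derivative_mul, map_sub, map_mul, map_add, map_pow]
      field_simp
      ring)

theorem deriv_ratFunc_div (p q : C[X]) (hq : q ≠ 0) :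
    (algebraMap C[X] (RatFunc C) p / algebraMap C[X] (RatFunc C) q)′ =
      algebraMap C[X] (RatFunc C)
          (Polynomial.derivative p * q - p * Polynomial.derivative q) /
        algebraMap C[X] (RatFunc C) (q ^ 2) :=
  ratFuncDeriv_div p q hq

end RatFuncDeriv

section LaurentDeriv

variable {C : Type u} [Field C]

theorem laurentDeriv_coeff (f : LaurentSeries C) (n : ℤ) :
    (LaurentSeries.derivative C f).coeff n = ((n + 1 : ℤ) : C) * f.coeff (n + 1) := by
  simp

theorem laurentDeriv_mul (f g : LaurentSeries C) :
    LaurentSeries.derivative C (f * g) =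
      f * LaurentSeries.derivative C g + g * LaurentSeries.derivative C f := by
  -- multiply by `x` and compare coefficients of the Euler derivation `x d/dx`
  have hx : ∀ (h : LaurentSeries C) (n : ℤ),
      (HahnSeries.single 1 1 * LaurentSeries.derivative C h : LaurentSeries C).coeff n =
        (n : C) * h.coeff n := by
    intro h n
    have := HahnSeries.coeff_single_mul_add (r := (1 : C))
      (x := LaurentSeries.derivative C h) (a := n - 1) (b := (1 : ℤ))
    rw [sub_add_cancel] at this
    rw [this, laurentDeriv_coeff, sub_add_cancel, one_mul]
  have hs : ∀ h : LaurentSeries C,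
      (HahnSeries.single 1 1 * LaurentSeries.derivative C h : LaurentSeries C).support ⊆
        h.support := by
    intro h n hn
    rw [HahnSeries.mem_support, hx] at hn
    exact right_ne_zero_of_mul hn
  have key : (HahnSeries.single 1 1 * LaurentSeries.derivative C (f * g) : LaurentSeries C) =
      f * (HahnSeries.single 1 1 * LaurentSeries.derivative C g) +
        HahnSeries.single 1 1 * LaurentSeries.derivative C f * g := by
    ext n
    rw [hx, HahnSeries.coeff_add, HahnSeries.coeff_mul_right' g.isPWO_support (hs g),
      HahnSeries.coeff_mul_left' f.isPWO_support (hs f), HahnSeries.coeff_mul, Finset.mul_sum,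
      ← Finset.sum_add_distrib]
    refine Finset.sum_congr rfl fun ij hij => ?_
    have h : ij.1 + ij.2 = n := (Finset.mem_antidiagonal.mp hij).2.2
    rw [hx, hx, ← h]
    push_cast
    ring
  have h1 : (HahnSeries.single 1 1 : LaurentSeries C) ≠ 0 := by simp
  apply mul_left_cancel₀ h1
  rw [key]
  ring

/-- `C((x))` as a differential field, with the termwise derivative. -/
instance laurentDifferential : Differential (LaurentSeries C) :=
  mkDifferential (LaurentSeries.derivative C).toAddMonoidHom laurentDeriv_mul

theorem deriv_laurent (f : LaurentSeries C) : f′ = LaurentSeries.derivative C f := rfl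

/-- The expansion map `C(x) → C((x))` commutes with the derivations. -/
instance : DifferentialAlgebra (RatFunc C) (LaurentSeries C) where
  deriv_algebraMap := by
    have hp : ∀ p : C[X], (algebraMap C[X] (LaurentSeries C) p)′ =
        algebraMap C[X] (LaurentSeries C) (Polynomial.derivative p) := by
      have hm : ∀ (n : ℕ) (c : C), algebraMap C[X] (LaurentSeries C)
          (Polynomial.monomial n c) = HahnSeries.single (n : ℤ) c := by
        intro n c
        rw [HahnSeries.algebraMap_apply']
        have h : algebraMap C[X] (PowerSeries C) (Polynomial.monomial n c) =
            PowerSeries.C c * PowerSeries.X ^ n := by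
          rw [PowerSeries.algebraMap_apply', ← Polynomial.C_mul_X_pow_eq_monomial]
          simp
        simp [h, HahnSeries.ofPowerSeries_C, HahnSeries.ofPowerSeries_X_pow]
      intro p
      induction p using Polynomial.induction_on' with
      | add p q hp hq => simp only [map_add, hp, hq]
      | monomial n c =>
        rw [Polynomial.derivative_monomial, hm, hm, deriv_laurent,
          LaurentSeries.derivative_apply]
        rcases n with _ | n
        · simp
        · simp [mul_comm]
    intro a
    induction a using RatFunc.induction_on with
    | f p q hq =>
    have h1 : algebraMap C[X] (LaurentSeries C) q ≠ 0 := fun h => hq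
      (FaithfulSMul.algebraMap_injective C[X] (LaurentSeries C) (by rw [h, map_zero]))
    rw [deriv_ratFunc_div p q hq, RatFunc.algebraMap_apply_div, RatFunc.algebraMap_apply_div,
      deriv_div_eq, hp, hp]
    simp only [map_sub, map_mul, map_pow]
    field_simp

end LaurentDeriv

/-! ### The Ore algebra `C(x)[D]` -/

section Operators

variable {C : Type u} [Field C]

/-- Linear differential operators `ℓ₀ + ℓ₁ D + ⋯ + ℓᵣ Dʳ` with coefficients in `C(x)`, written with
the coefficients on the left.  The additive group is that of polynomials in a symbol `X = D`;
the (noncommutative) product of operators is `DiffOp.mul` below, *not* the polynomial product. -/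
abbrev DiffOp (C : Type u) [Field C] : Type u := Polynomial (RatFunc C)

/-- The order of an operator (only meaningful for nonzero operators). -/
def DiffOp.ord (L : DiffOp C) : ℕ := L.natDegree

/-- `D · (∑ qᵢ Dⁱ) = ∑ (qᵢ Dⁱ⁺¹ + qᵢ' Dⁱ)`. -/
def DiffOp.leftD (Q : DiffOp C) : DiffOp C := Polynomial.X * Q + Differential.mapCoeffs Q

/-- The product of `C(x)[D]`: `(∑ aᵢ Dⁱ) · Q = ∑ aᵢ (D ⋯ (D · Q))`. -/
def DiffOp.mul (P Q : DiffOp C) : DiffOp C := P.sum fun i a => a • DiffOp.leftD^[i] Q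

/-- `P` is a right factor of `M`. -/
def IsRightFactor (P M : DiffOp C) : Prop := ∃ R : DiffOp C, M = DiffOp.mul R P

/-- `L · f = ∑ ℓᵢ f⁽ⁱ⁾` for `f` in a differential ring containing `C(x)`. -/
def DiffOp.act {F : Type u} [CommRing F] [Differential F] [Algebra (RatFunc C) F]
    (L : DiffOp C) (f : F) : F :=
  L.sum fun i a => algebraMap (RatFunc C) F a * (fun g : F => g′)^[i] f

/-- An operator is primitive if its coefficients are coprime polynomials and its leading
coefficient is a monic polynomial. -/
def IsPrimitiveOp (Q : DiffOp C) : Prop :=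
  ∃ q : Polynomial C[X], Q = q.map (algebraMap C[X] (RatFunc C)) ∧
    q.IsPrimitive ∧ q.leadingCoeff.Monic

/-- All coefficients of `Q` are polynomials of degree at most `d`. -/
def CoeffDegreesLE (Q : DiffOp C) (d : ℤ) : Prop :=
  ∀ i, ∃ p : C[X], Q.coeff i = algebraMap C[X] (RatFunc C) p ∧ (p.natDegree : ℤ) ≤ d

/-- `0` is an ordinary point of `L`: it is not a pole of any `ℓᵢ / ℓᵣ`. -/
def IsOrdinaryAtZero (L : DiffOp C) : Prop :=
  L ≠ 0 ∧ ∀ i, (L.coeff i / L.leadingCoeff).denom.eval 0 ≠ 0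

/-! ### Symmetric products -/

/-- `P` annihilates `f g` for all solutions `f` of `L₁` and `g` of `L₂` in any differential
ring extension of `C(x)`. -/
def AnnihilatesProducts (L₁ L₂ P : DiffOp C) : Prop :=
  ∀ (F : Type u) [CommRing F] [Differential F] [Algebra (RatFunc C) F]
    [DifferentialAlgebra (RatFunc C) F] (f g : F),
    L₁.act f = 0 → L₂.act g = 0 → P.act (f * g) = 0

/-- `P` is the primitive operator of lowest order annihilating all products of a solution
of `L₁` and a solution of `L₂`. -/
def IsSymProd (L₁ L₂ P : DiffOp C) : Prop :=
  IsPrimitiveOp P ∧ AnnihilatesProducts L₁ L₂ P ∧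
    ∀ P' : DiffOp C, P' ≠ 0 → AnnihilatesProducts L₁ L₂ P' → P.ord ≤ P'.ord

open Classical in
/-- The symmetric product `L₁ ⊗ L₂` (of nonzero operators). -/
def symProd (L₁ L₂ : DiffOp C) : DiffOp C :=
  if h : ∃ P, IsSymProd L₁ L₂ P then h.choose else 0

/-- The symmetric power `L^{⊗ s}`; the empty symmetric product is `D`, whose solutions are the
constants, the neutral element for `⊗`. -/
def symPow (L : DiffOp C) : ℕ → DiffOp C
  | 0 => Polynomial.X
  | s + 1 => symProd L (symPow L s)

/-! ### Series solutions, truncations and colon spaces -/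

theorem laurent_deriv_smul (c : C) (f : LaurentSeries C) : (c • f)′ = c • f′ := by
  rw [deriv_laurent, deriv_laurent, map_smul]

instance laurent_isScalarTower : IsScalarTower C (LaurentSeries C) (LaurentSeries C) :=
  ⟨fun c f g => by
    simp only [smul_eq_mul, ← HahnSeries.C_mul_eq_smul, mul_assoc]⟩

theorem laurent_mul_smul (c : C) (a f : LaurentSeries C) : a * (c • f) = c • (a * f) := by
  rw [mul_comm, smul_mul_assoc, mul_comm]

/-- `V(L)`: the `C`-vector space of solutions of `L` in `C((x))`. -/
def solutionSpace (L : DiffOp C) : Submodule C (LaurentSeries C) where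
  carrier := {f | L.act f = 0}
  zero_mem' := by
    have h : ∀ i : ℕ, (fun g : LaurentSeries C => g′)^[i] 0 = 0 := fun i =>
      Function.iterate_fixed (map_zero _) i
    simp [DiffOp.act, Polynomial.sum, h]
  add_mem' := by
    intro f g hf hg
    have h : ∀ i : ℕ, (fun g : LaurentSeries C => g′)^[i] (f + g) =
        (fun g : LaurentSeries C => g′)^[i] f + (fun g : LaurentSeries C => g′)^[i] g := by
      intro i
      induction i with
      | zero => rfl
      | succ i ih => simp only [Function.iterate_succ', Function.comp_apply, ih, map_add]
    simp only [Set.mem_ofPred_eq, DiffOp.act, Polynomial.sum] at hf hg ⊢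
    simp only [h, mul_add, Finset.sum_add_distrib, hf, hg, add_zero]
  smul_mem' := by
    intro c f hf
    have h : ∀ i : ℕ, (fun g : LaurentSeries C => g′)^[i] (c • f) =
        c • (fun g : LaurentSeries C => g′)^[i] f := by
      intro i
      induction i with
      | zero => rfl
      | succ i ih => simp only [Function.iterate_succ', Function.comp_apply, ih,
          laurent_deriv_smul]
    simp only [Set.mem_ofPred_eq, DiffOp.act, Polynomial.sum] at hf ⊢
    simp only [h, laurent_mul_smul, ← Finset.smul_sum, hf, smul_zero]

/-- The colon space `(V : U) = {h ∈ K | h U ⊆ V}` in a commutative `C`-algebra `K`. -/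
def colonSpace {K : Type u} [CommRing K] [Module C K] [IsScalarTower C K K]
    (V : Submodule C K) (U : Set K) : Submodule C K where
  carrier := {h | ∀ u ∈ U, h * u ∈ V}
  zero_mem' := fun u _ => by simp
  add_mem' := fun ha hb u hu => by rw [add_mul]; exact V.add_mem (ha u hu) (hb u hu)
  smul_mem' := fun c h hh u hu => by rw [smul_mul_assoc]; exact V.smul_mem c (hh u hu)

/-- `(V(M) : V(L))` in `C((x))`. -/
def solColon (M L : DiffOp C) : Submodule C (LaurentSeries C) :=
  colonSpace (solutionSpace M) (solutionSpace L : Set (LaurentSeries C))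

/-- The truncation `T_k`, which keeps the terms `aᵢ xⁱ` with `i ≤ k`. -/
def truncate (k : ℤ) : LaurentSeries C →ₗ[C] LaurentSeries C :=
  HahnSeries.truncLTLinearMap C (k + 1)

/-- `f = O(x^m)`. -/
def IsBigOX (f : LaurentSeries C) (m : ℤ) : Prop := ∀ n < m, f.coeff n = 0

/-! ### Indicial polynomials -/

/-- `p` is the indicial polynomial of `N` at `0`: it is nonzero and, for some `σ ∈ ℤ` and all
`s ∈ ℕ`, `N · x^s = p(s) x^{s+σ} + (terms of higher degree)`. -/
def IsIndicialPoly (N : DiffOp C) (p : C[X]) : Prop :=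
  p ≠ 0 ∧ ∃ σ : ℤ, ∀ s : ℕ,
    IsBigOX (N.act (HahnSeries.single (s : ℤ) (1 : C) : LaurentSeries C)) (s + σ) ∧
    (N.act (HahnSeries.single (s : ℤ) (1 : C) : LaurentSeries C)).coeff (s + σ) =
      p.eval (s : C)

/-- `Z_N`: the set of nonnegative integer roots of the indicial polynomial of `N` at `0`. -/
def indicialRoots (N : DiffOp C) : Set ℕ :=
  {k | ∃ p, IsIndicialPoly N p ∧ p.eval (k : C) = 0}

/-! ### Quasi-symmetric quotients -/

/-- `Q` is the (global) quasi-symmetric quotient of `M` by `L`: the primitive operator of maximal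
order such that `L ⊗ Q` is a right factor of `M`. -/
def IsGlobalQuasiSymQuotient (M L Q : DiffOp C) : Prop :=
  IsPrimitiveOp Q ∧ IsRightFactor (symProd L Q) M ∧
    ∀ P : DiffOp C, P ≠ 0 → IsRightFactor (symProd L P) M → P.ord ≤ Q.ord

/-- `Q` is a local quasi-symmetric quotient of `M` by `L` at `0`: a primitive operator with
`V(Q) = (V(M) : V(L))` such that `L ⊗ Q` is a right factor of `M`. -/
def IsLocalQuasiSymQuotient (M L Q : DiffOp C) : Prop :=
  IsPrimitiveOp Q ∧ solutionSpace Q = solColon M L ∧ IsRightFactor (symProd L Q) M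

/-! ### Input-output specifications of the subroutines -/

/-- `δ` is the output of `ColonSpaceDimension(M, L)`: the dimension of `(V(M) : V(L))`. -/
def ColonSpaceDimension (M L : DiffOp C) (δ : ℕ) : Prop :=
  Module.rank C (solColon M L) = (δ : Cardinal)

/-- `(h₁, …, h_δ)` is a possible output of `ColonSpaceBasis(M, L, k)`: a basis of the truncation
of `(V(M) : V(L))` at precision `k`. -/
def ColonSpaceBasis (M L : DiffOp C) (k : ℤ) {δ : ℕ} (h : Fin δ → LaurentSeries C) : Prop :=
  LinearIndependent C h ∧
    Submodule.span C (Set.range h) = (solColon M L).map (truncate k)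

/-- `d₀` is a possible output of `BoundDegreeOfQuasiSymmetricQuotientCoeffs(M, L, δ)`: a bound on
the degrees of the coefficients of an order-`δ` global quasi-symmetric quotient. -/
def BoundDegree (M L : DiffOp C) (δ d₀ : ℕ) : Prop :=
  ∀ Q : DiffOp C, IsGlobalQuasiSymQuotient M L Q → Q.ord = δ → CoeffDegreesLE Q d₀

/-- `Q` is a primitive operator `q₀ + ⋯ + q_δ D^δ` with `deg qᵢ ≤ d` such that
`Q · hⱼ = O(x^{k-δ})` for all `j`. -/
def IsApproximant {δ : ℕ} (h : Fin δ → LaurentSeries C) (d k : ℤ) (Q : DiffOp C) : Prop :=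
  IsPrimitiveOp Q ∧ Q.ord ≤ δ ∧ CoeffDegreesLE Q d ∧ ∀ j, IsBigOX (Q.act (h j)) (k - δ)

/-- The result is a possible output of `ApproximantAnnihilator(h₁, …, h_δ; d, …, d; k)`: some
approximant, or `none` (the paper's `∅`) if there is no approximant. -/
def ApproximantAnnihilator {δ : ℕ} (h : Fin δ → LaurentSeries C) (d k : ℤ) :
    Option (DiffOp C) → Prop
  | some Q => IsApproximant h d k Q
  | none => ¬ ∃ Q, IsApproximant h d k Q

/-! ### The algorithm as a transition system -/

/-- The states of the algorithm `QuasiSymmetricQuotientAtZero`: a program position together with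
the current values of the program variables. -/
inductive State (C : Type u) [Field C] : Type u
  | start : State C
  /-- `δ` has been computed -/
  | dimension (δ : ℕ) : State C
  /-- `k` has been initialised -/
  | precision (δ : ℕ) (k : ℤ) : State C
  /-- head of the `while true` loop -/
  | loop (δ d₀ : ℕ) (k : ℤ) : State C
  /-- the truncated basis `h₁, …, h_δ` has been computed -/
  | basis (δ d₀ : ℕ) (k : ℤ) (h : Fin δ → LaurentSeries C) : State C
  /-- the result of the approximant annihilator has been computed -/
  | candidate (δ d₀ : ℕ) (k : ℤ) (Q : Option (DiffOp C)) : State C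
  /-- the algorithm has returned (`none` stands for the answer `None`) -/
  | returned (res : Option (DiffOp C)) : State C

/-- The steps of `QuasiSymmetricQuotientAtZero(M, L)`.  A call of a subroutine may produce any
output that its specification allows. -/
inductive Step (M L : DiffOp C) : State C → State C → Prop
  /-- `δ := ColonSpaceDimension(M, L)` -/
  | dimension (δ : ℕ) : ColonSpaceDimension M L δ → Step M L .start (.dimension δ)
  /-- if `δ = 0`, return `1` -/
  | trivial : Step M L (.dimension 0) (.returned (some 1))
  /-- if `δ > 0`, set `k := k₀ + 1`, where `k₀ = max Z_N - r(r-1)/2` with `r = ord L` and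
  `N = M ⊗ L^{⊗(r-1)}` -/
  | precision (δ z : ℕ) : 0 < δ →
      IsGreatest (indicialRoots (symProd M (symPow L (L.ord - 1)))) z →
      Step M L (.dimension δ)
        (.precision δ ((z : ℤ) - (L.ord * (L.ord - 1) / 2 : ℕ) + 1))
  /-- `d₀ := BoundDegreeOfQuasiSymmetricQuotientCoeffs(M, L, δ)` -/
  | bound (δ d₀ : ℕ) (k : ℤ) : BoundDegree M L δ d₀ →
      Step M L (.precision δ k) (.loop δ d₀ k)
  /-- `{h₁, …, h_δ} := ColonSpaceBasis(M, L, k)` -/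
  | basis (δ d₀ : ℕ) (k : ℤ) (h : Fin δ → LaurentSeries C) : ColonSpaceBasis M L k h →
      Step M L (.loop δ d₀ k) (.basis δ d₀ k h)
  /-- `d := min {d₀, ⌊(k - δ) / (δ + 1)⌋}` and
  `Q := ApproximantAnnihilator(h₁, …, h_δ; d, …, d; k)` -/
  | approximant (δ d₀ : ℕ) (k : ℤ) (h : Fin δ → LaurentSeries C) (Q : Option (DiffOp C)) :
      ApproximantAnnihilator h (min (d₀ : ℤ) ⌊((k - δ : ℤ) : ℚ) / ((δ + 1 : ℤ) : ℚ)⌋) k Q →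
      Step M L (.basis δ d₀ k h) (.candidate δ d₀ k Q)
  /-- if `Q = ∅` and `k ≥ (δ + 1)(d₀ + 1) + δ`, return `None` -/
  | returnNone (δ d₀ : ℕ) (k : ℤ) : ((δ : ℤ) + 1) * (d₀ + 1) + δ ≤ k →
      Step M L (.candidate δ d₀ k none) (.returned none)
  /-- if `Q ≠ ∅`, `ord Q = δ` and `L ⊗ Q` is a right factor of `M`, return `Q` -/
  | returnSome (δ d₀ : ℕ) (k : ℤ) (Q : DiffOp C) : Q.ord = δ → IsRightFactor (symProd L Q) M →
      Step M L (.candidate δ d₀ k (some Q)) (.returned (some Q))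
  /-- otherwise `k := 2k` (here `Q = ∅`) -/
  | doubleNone (δ d₀ : ℕ) (k : ℤ) : ¬ ((δ : ℤ) + 1) * (d₀ + 1) + δ ≤ k →
      Step M L (.candidate δ d₀ k none) (.loop δ d₀ (2 * k))
  /-- otherwise `k := 2k` (here `Q ≠ ∅`) -/
  | doubleSome (δ d₀ : ℕ) (k : ℤ) (Q : DiffOp C) :
      ¬ (Q.ord = δ ∧ IsRightFactor (symProd L Q) M) →
      Step M L (.candidate δ d₀ k (some Q)) (.loop δ d₀ (2 * k))

/-- The states that occur in runs of `QuasiSymmetricQuotientAtZero(M, L)`. -/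
def Reachable (M L : DiffOp C) (s : State C) : Prop :=
  Relation.ReflTransGen (Step M L) .start s

end Operators

end SymDiv

end

/-! The central fact is that a local quasi-symmetric quotient always exists at an ordinary point.
Write `r` for the order of `L`. For every `f` with `L · f = 0` and every `g`, repeated use of the
product rule and reduction of `f⁽ʳ⁾` by `L` give `M · (f g) = ∑_{i<r} f⁽ⁱ⁾ (Aᵢ · g)`, where the
operators `Aᵢ = expansion L M i` depend on neither `f` nor `g` (`act_mul_eq_expansion`). Let `G` be
the primitive greatest common right divisor of the `Aᵢ`.

Since 0 is ordinary, `L` has `r` independent solutions in `C((x))` and their Wronskian matrix is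
invertible. Hence `h` lies in the colon space iff every `Aᵢ` kills `h`, that is, iff `G` does
(`mem_solColon_iff`). The operator `A₀` has the order and leading coefficient of `M` and is again
regular at 0, so it has a full solution space. Its right factor `G` inherits this, and therefore the
colon space has dimension `ord G`.

Moreover `L ⊗ Q` is a right factor of `M` iff `Q` right-divides all the `Aᵢ`, hence iff `Q`
right-divides `G`. The nontrivial direction (`AnnihilatesProducts.expansion_mem`) evaluates the
identity at a generic solution of `Q`: the class of 1 in `C((x))[D]/C((x))[D]Q`, turned into a ring
element by a square-zero extension. `exists_quotient` collects these properties of `G`, and the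
analysis of the algorithm uses only them and bounds on orders of vanishing.

For correctness, a returned `Q` of order `δ = ord G` right-divides `G`, so it is a rational multiple
of `G`. The answer None never occurs: once the precision admits degree `d₀`, the operator `G` itself
is an approximant.

The initial precision is justified by multiplying `h` in the colon space with solutions of `L` of
orders `0, …, r-1`. The product solves `N` and has order `ord h + r(r-1)/2`, which must be an
indicial root (`order_mem_indicialRoots`). So truncation is injective on the colon space.

For termination, operators of bounded order and degree map the colon space into one fixed
finite-dimensional space. At high precision an approximant must therefore annihilate the colon space
exactly, which forces it to be a multiple of `G` (`GovernsQuotients.exists_precision`). -/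

noncomputable section

namespace SymDiv

variable {C : Type u} [Field C]

/-! ### Modules with a connection over `C(x)` -/

section Connection

variable {E E' : Type*} [AddCommGroup E] [Module (RatFunc C) E] [AddCommGroup E']
  [Module (RatFunc C) E']

/-- An additive map is a connection if it satisfies the product rule. -/
def IsConnection (C : Type u) [Field C] {E : Type*} [AddCommGroup E] [Module (RatFunc C) E]
    (d : E →+ E) : Prop :=
  ∀ (a : RatFunc C) (e : E), d (a • e) = a′ • e + a • d e

/-- The action of operators on the element `e`, where `D` acts by `d`. -/
def opAct (d : E →+ E) (e : E) : DiffOp C →ₗ[RatFunc C] E :=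
  Polynomial.lsum fun i => LinearMap.toSpanSingleton (RatFunc C) E (d^[i] e)

theorem opAct_apply (d : E →+ E) (e : E) (P : DiffOp C) :
    opAct d e P = P.sum fun i a => a • d^[i] e := rfl

@[simp]
theorem opAct_monomial (d : E →+ E) (e : E) (n : ℕ) (a : RatFunc C) :
    opAct d e (Polynomial.monomial n a) = a • d^[n] e := by
  simp [opAct_apply, Polynomial.sum_monomial_index]

theorem opAct_one (d : E →+ E) (e : E) : opAct d e (1 : DiffOp C) = e := by
  simpa using opAct_monomial d e 0 (1 : RatFunc C)

theorem leftD_monomial (n : ℕ) (a : RatFunc C) :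
    DiffOp.leftD (Polynomial.monomial n a : DiffOp C) =
      Polynomial.monomial (n + 1) a + Polynomial.monomial n a′ := by
  rw [DiffOp.leftD, Polynomial.X_mul_monomial]
  congr 1
  ext i
  rw [Differential.coeff_mapCoeffs, Polynomial.coeff_monomial, Polynomial.coeff_monomial]
  split_ifs <;> simp

/-- Left multiplication by `D` as an additive map. -/
def leftDHom : DiffOp C →+ DiffOp C where
  toFun := DiffOp.leftD
  map_zero' := by simp [DiffOp.leftD]
  map_add' P Q := by simp only [DiffOp.leftD, map_add, mul_add]; abel

theorem leftDHom_apply (P : DiffOp C) : leftDHom P = P.leftD := rfl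

/-- With this, the operator product is itself an instance of `opAct`, and its algebraic laws become
cases of naturality. -/
theorem leftD_isConnection : IsConnection C (leftDHom (C := C)) := by
  intro a P
  ext i
  rcases i with _ | i <;>
    simp [leftDHom_apply, DiffOp.leftD, Polynomial.coeff_X_mul] <;> ring

theorem opAct_leftD {d : E →+ E} (hd : IsConnection C d) (e : E) (P : DiffOp C) :
    opAct d e P.leftD = d (opAct d e P) := by
  rw [← leftDHom_apply]
  induction P using Polynomial.induction_on' with
  | add p q hp hq => simp only [map_add, hp, hq]
  | monomial n a =>
    rw [leftDHom_apply, leftD_monomial, map_add, opAct_monomial, opAct_monomial, opAct_monomial,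
      hd, Function.iterate_succ_apply', add_comm]

/-- Naturality of the action under horizontal maps. It is used with the orbit map of an element,
with evaluation of an expansion, and with the inclusions into a square-zero extension. -/
theorem map_opAct {d : E →+ E} {d' : E' →+ E'} (φ : E →ₗ[RatFunc C] E')
    (h : ∀ e, φ (d e) = d' (φ e)) (e : E) (P : DiffOp C) :
    φ (opAct d e P) = opAct d' (φ e) P := by
  have hi : ∀ n, φ (d^[n] e) = d'^[n] (φ e) := by
    intro n
    induction n with
    | zero => rfl
    | succ n ih => rw [Function.iterate_succ_apply', h, ih, Function.iterate_succ_apply']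
  induction P using Polynomial.induction_on' with
  | add p q hp hq => simp only [map_add, hp, hq]
  | monomial n a => simp only [opAct_monomial, map_smul, hi]

theorem mul_eq_opAct (P Q : DiffOp C) : DiffOp.mul P Q = opAct leftDHom Q P := rfl

theorem leftD_mul (P Q : DiffOp C) : DiffOp.mul P.leftD Q = (DiffOp.mul P Q).leftD :=
  opAct_leftD leftD_isConnection Q P

/-- The orbit map `P ↦ P · e` intertwines left multiplication by `D` with `d`, so associativity is
naturality for this map. -/
theorem opAct_mul {d : E →+ E} (hd : IsConnection C d) (e : E) (P Q : DiffOp C) :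
    opAct d e (DiffOp.mul P Q) = opAct d (opAct d e Q) P := by
  rw [mul_eq_opAct]
  exact map_opAct (opAct d e) (fun R => opAct_leftD hd e R) Q P

end Connection

/-! ### Differential rings over `C(x)` -/

section Act

variable {F : Type u} [CommRing F] [Differential F] [Algebra (RatFunc C) F]

/-- The derivation of a differential ring as an additive map. -/
def derivHom (F : Type*) [CommRing F] [Differential F] : F →+ F :=
  (Differential.deriv : Derivation ℤ F F).toLinearMap.toAddMonoidHom

theorem derivHom_apply (f : F) : derivHom F f = f′ := rfl

theorem coe_derivHom : (derivHom F : F → F) = fun g => g′ := rfl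

theorem derivHom_isConnection [DifferentialAlgebra (RatFunc C) F] :
    IsConnection C (derivHom F) := by
  intro a f
  rw [derivHom_apply, derivHom_apply, Algebra.smul_def, Derivation.leibniz, deriv_algebraMap,
    smul_eq_mul, smul_eq_mul, Algebra.smul_def, Algebra.smul_def]
  ring

theorem act_eq_opAct (P : DiffOp C) (f : F) : P.act f = opAct (derivHom F) f P := by
  simp only [DiffOp.act, opAct_apply, Algebra.smul_def, coe_derivHom]

theorem act_zero_left (f : F) : (0 : DiffOp C).act f = 0 := by
  rw [act_eq_opAct, map_zero]

theorem act_add (P Q : DiffOp C) (f : F) : (P + Q).act f = P.act f + Q.act f := by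
  simp only [act_eq_opAct, map_add]

theorem act_sub (P Q : DiffOp C) (f : F) : (P - Q).act f = P.act f - Q.act f := by
  simp only [act_eq_opAct, map_sub]

theorem act_smul (a : RatFunc C) (P : DiffOp C) (f : F) :
    (a • P).act f = algebraMap (RatFunc C) F a * P.act f := by
  rw [act_eq_opAct, act_eq_opAct, map_smul, Algebra.smul_def]

theorem act_one (f : F) : (1 : DiffOp C).act f = f := by
  rw [act_eq_opAct, opAct_one]

theorem act_X (f : F) : DiffOp.act (Polynomial.X : DiffOp C) f = f′ := by
  rw [act_eq_opAct, ← Polynomial.monomial_one_one_eq_X, opAct_monomial, one_smul]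
  rfl

theorem act_leftD [DifferentialAlgebra (RatFunc C) F] (P : DiffOp C) (f : F) :
    P.leftD.act f = (P.act f)′ := by
  simp only [act_eq_opAct, opAct_leftD derivHom_isConnection, derivHom_apply]

theorem act_mul [DifferentialAlgebra (RatFunc C) F] (P Q : DiffOp C) (f : F) :
    (DiffOp.mul P Q).act f = P.act (Q.act f) := by
  simp only [act_eq_opAct, opAct_mul derivHom_isConnection]

theorem act_eq_sum_range (P : DiffOp C) {n : ℕ} (hn : P.natDegree < n) (f : F) :
    P.act f = ∑ i ∈ Finset.range n,
      algebraMap (RatFunc C) F (P.coeff i) * (fun g : F => g′)^[i] f :=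
  Polynomial.sum_over_range' P (by simp) n hn

theorem iterate_deriv_add (i : ℕ) (f g : F) :
    (fun g : F => g′)^[i] (f + g) = (fun g : F => g′)^[i] f + (fun g : F => g′)^[i] g := by
  rw [← coe_derivHom]
  exact iterate_map_add (derivHom F) i f g

theorem iterate_deriv_zero (i : ℕ) : (fun g : F => g′)^[i] 0 = 0 := by
  rw [← coe_derivHom]
  exact iterate_map_zero (derivHom F) i

theorem act_zero (P : DiffOp C) : P.act (0 : F) = 0 := by
  simp only [DiffOp.act, Polynomial.sum, iterate_deriv_zero, mul_zero, Finset.sum_const_zero]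

theorem act_add_right (P : DiffOp C) (f g : F) : P.act (f + g) = P.act f + P.act g := by
  simp only [DiffOp.act, Polynomial.sum, iterate_deriv_add, mul_add, Finset.sum_add_distrib]

end Act

/-! ### Left ideals of `C(x)[D]` -/

section LeftIdeal

/-- A subspace of `C(x)[D]` is a left ideal if it is stable under left multiplication by `D`. -/
def IsLeftIdeal (I : Submodule (RatFunc C) (DiffOp C)) : Prop :=
  ∀ P ∈ I, DiffOp.leftD P ∈ I

/-- The left ideal generated by `Q`. -/
def principal (Q : DiffOp C) : Submodule (RatFunc C) (DiffOp C) :=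
  LinearMap.range (opAct leftDHom Q)

theorem mem_principal {P Q : DiffOp C} : P ∈ principal Q ↔ IsRightFactor Q P := by
  simp only [principal, LinearMap.mem_range, IsRightFactor, mul_eq_opAct, eq_comm]

theorem isLeftIdeal_principal (Q : DiffOp C) : IsLeftIdeal (principal Q) := by
  rintro _ ⟨R, rfl⟩
  exact ⟨R.leftD, leftD_mul R Q⟩

theorem self_mem_principal (Q : DiffOp C) : Q ∈ principal Q :=
  ⟨1, opAct_one _ _⟩

theorem IsLeftIdeal.mul_mem {I : Submodule (RatFunc C) (DiffOp C)} (hI : IsLeftIdeal I)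
    {P : DiffOp C} (hP : P ∈ I) (R : DiffOp C) : DiffOp.mul R P ∈ I := by
  have hi : ∀ n, leftDHom^[n] P ∈ I := by
    intro n
    induction n with
    | zero => exact hP
    | succ n ih => rw [Function.iterate_succ_apply']; exact hI _ ih
  rw [mul_eq_opAct, opAct_apply, Polynomial.sum]
  exact I.sum_mem fun i _ => I.smul_mem _ (hi i)

theorem IsLeftIdeal.principal_le {I : Submodule (RatFunc C) (DiffOp C)} (hI : IsLeftIdeal I)
    {P : DiffOp C} (hP : P ∈ I) : principal P ≤ I := by
  rintro _ ⟨R, rfl⟩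
  exact hI.mul_mem hP R

theorem degree_leftD (P : DiffOp C) : P.leftD.degree = P.degree + 1 := by
  rcases eq_or_ne P 0 with rfl | h
  · simp [DiffOp.leftD]
  have h1 : (Polynomial.X * P).degree = P.degree + 1 := by
    rw [Polynomial.degree_mul, Polynomial.degree_X, add_comm]
  have h2 : (Differential.mapCoeffs P).degree < P.degree + 1 := by
    have h3 : (P.natDegree : WithBot ℕ) + 1 = ((P.natDegree + 1 : ℕ) : WithBot ℕ) := by simp
    rw [Polynomial.degree_eq_natDegree h, h3, Polynomial.degree_lt_iff_coeff_zero]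
    intro m hm
    rw [Differential.coeff_mapCoeffs, Polynomial.coeff_eq_zero_of_natDegree_lt (by omega), map_zero]
  rw [DiffOp.leftD, Polynomial.degree_add_eq_left_of_degree_lt (h1 ▸ h2), h1]

theorem leadingCoeff_leftD (P : DiffOp C) : P.leftD.leadingCoeff = P.leadingCoeff := by
  rcases eq_or_ne P 0 with rfl | h
  · simp [DiffOp.leftD]
  have hn : P.leftD.natDegree = P.natDegree + 1 := by
    apply Polynomial.natDegree_eq_of_degree_eq_some
    rw [degree_leftD, Polynomial.degree_eq_natDegree h]; simp
  rw [Polynomial.leadingCoeff, hn, DiffOp.leftD, Polynomial.coeff_add, Polynomial.coeff_X_mul,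
    Differential.coeff_mapCoeffs, Polynomial.coeff_natDegree_succ_eq_zero,
    map_zero, add_zero, Polynomial.leadingCoeff]

theorem degree_iterate_leftD (n : ℕ) (P : DiffOp C) :
    (leftDHom^[n] P).degree = P.degree + n := by
  induction n with
  | zero => simp
  | succ n ih =>
    rw [Function.iterate_succ_apply', leftDHom_apply, degree_leftD, ih, add_assoc]; simp

/-- Right division with remainder. -/
theorem exists_mul_add (Q : DiffOp C) (hQ : Q ≠ 0) (P : DiffOp C) :
    ∃ R S : DiffOp C, P = DiffOp.mul R Q + S ∧ S.degree < Q.degree := by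
  induction hn : P.natDegree using Nat.strong_induction_on generalizing P with
  | _ n ih =>
  by_cases hlt : P.degree < Q.degree
  · exact ⟨0, P, by simp [mul_eq_opAct], hlt⟩
  push Not at hlt
  have hP : P ≠ 0 := by rintro rfl; simp at hlt; exact hQ hlt
  -- Left multiplication by `D` raises the order by one, so a scalar multiple of this shift of `Q`
  -- cancels the leading term of `P`.
  set T := leftDHom^[P.natDegree - Q.natDegree] Q
  have hle := Polynomial.natDegree_le_natDegree hlt
  have hTd : T.degree = P.degree := by
    rw [degree_iterate_leftD, Polynomial.degree_eq_natDegree hQ, Polynomial.degree_eq_natDegree hP,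
      ← Nat.cast_add]
    congr 1
    omega
  have hT0 : T ≠ 0 := by
    intro h; rw [h, Polynomial.degree_zero, eq_comm, Polynomial.degree_eq_bot] at hTd; exact hP hTd
  set c := P.leadingCoeff / T.leadingCoeff
  have hc : c ≠ 0 := div_ne_zero (by simpa using hP) (by simpa using hT0)
  have hsub : (P - c • T).degree < P.degree := by
    apply Polynomial.degree_sub_lt_left _ hP
    · rw [Polynomial.smul_eq_C_mul, Polynomial.leadingCoeff_mul, Polynomial.leadingCoeff_C,
        div_mul_cancel₀ _ (by simpa using hT0)]
    · rw [Polynomial.degree_smul_of_smul_regular _ (IsSMulRegular.of_ne_zero hc), hTd]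
  obtain ⟨R, S, h1, h2⟩ : ∃ R S : DiffOp C, P - c • T = DiffOp.mul R Q + S ∧
      S.degree < Q.degree := by
    by_cases h0 : P - c • T = 0
    · exact ⟨0, 0, by simp [mul_eq_opAct, h0], by
        rw [Polynomial.degree_zero]; exact bot_lt_iff_ne_bot.2 (mt Polynomial.degree_eq_bot.1 hQ)⟩
    · exact ih _ (hn ▸ Polynomial.natDegree_lt_natDegree h0 hsub) _ rfl
  refine ⟨R + Polynomial.monomial (P.natDegree - Q.natDegree) c, S, ?_, h2⟩
  rw [mul_eq_opAct] at h1 ⊢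
  rw [map_add, opAct_monomial, add_right_comm, ← h1]
  simp [T]

/-- The top term of `R` alone contributes the top order, because `Dⁱ Q` has order exactly `i + ord
Q`; no cancellation is possible. -/
theorem degree_mul_op (R Q : DiffOp C) (hR : R ≠ 0) (hQ : Q ≠ 0) :
    (DiffOp.mul R Q).natDegree = R.natDegree + Q.natDegree ∧ DiffOp.mul R Q ≠ 0 := by
  have key : (DiffOp.mul R Q).degree = ((R.natDegree + Q.natDegree : ℕ) : WithBot ℕ) := by
    have hl : R.leadingCoeff ≠ 0 := by simpa using hR
    have h1 : (R.leadingCoeff • leftDHom^[R.natDegree] Q).degree =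
        ((R.natDegree + Q.natDegree : ℕ) : WithBot ℕ) := by
      rw [Polynomial.degree_smul_of_smul_regular _ (IsSMulRegular.of_ne_zero hl),
        degree_iterate_leftD, Polynomial.degree_eq_natDegree hQ]
      push_cast; ring
    have h2 : (DiffOp.mul R.eraseLead Q).degree <
        ((R.natDegree + Q.natDegree : ℕ) : WithBot ℕ) := by
      rw [mul_eq_opAct, opAct_apply, Polynomial.sum]
      refine (Polynomial.degree_sum_le _ _).trans_lt ?_
      rw [Finset.sup_lt_iff (by exact WithBot.bot_lt_coe _)]
      intro i hi
      refine (Polynomial.degree_smul_le _ _).trans_lt ?_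
      rw [degree_iterate_leftD, Polynomial.degree_eq_natDegree hQ, ← Nat.cast_add]
      have := Polynomial.lt_natDegree_of_mem_eraseLead_support hi
      exact_mod_cast (by omega)
    have h3 : DiffOp.mul R Q = DiffOp.mul R.eraseLead Q +
        R.leadingCoeff • leftDHom^[R.natDegree] Q := by
      simp only [mul_eq_opAct]
      conv_lhs => rw [← Polynomial.eraseLead_add_monomial_natDegree_leadingCoeff R]
      rw [map_add, opAct_monomial]
    rw [h3, Polynomial.degree_add_eq_right_of_degree_lt (h1 ▸ h2), h1]
  refine ⟨Polynomial.natDegree_eq_of_degree_eq_some key, fun h => ?_⟩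
  rw [h, Polynomial.degree_zero] at key
  exact absurd key.symm (by simp)

/-- An element of least order generates a left ideal. -/
theorem IsLeftIdeal.le_principal {I : Submodule (RatFunc C) (DiffOp C)} (hI : IsLeftIdeal I)
    {Q : DiffOp C} (hQ : Q ∈ I) (hQ0 : Q ≠ 0)
    (hmin : ∀ P ∈ I, P ≠ 0 → Q.natDegree ≤ P.natDegree) : I ≤ principal Q := by
  intro P hP
  obtain ⟨R, S, h, hS⟩ := exists_mul_add Q hQ0 P
  have hSI : S ∈ I := by
    have : S = P - DiffOp.mul R Q := by rw [h]; abel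
    rw [this]
    exact I.sub_mem hP (hI.mul_mem hQ R)
  by_cases hS0 : S = 0
  · exact ⟨R, by rw [h, hS0, add_zero, mul_eq_opAct]⟩
  · exact absurd (hmin S hSI hS0) (not_le.2 (Polynomial.natDegree_lt_natDegree hS0 hS))

theorem exists_minimal_natDegree {I : Submodule (RatFunc C) (DiffOp C)} (h : I ≠ ⊥) :
    ∃ Q ∈ I, Q ≠ 0 ∧ ∀ P ∈ I, P ≠ 0 → Q.natDegree ≤ P.natDegree := by
  obtain ⟨P, hP, hP0⟩ := I.ne_bot_iff.1 h
  let s : Set (DiffOp C) := {P | P ∈ I ∧ P ≠ 0}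
  have hs : s.Nonempty := ⟨P, hP, hP0⟩
  obtain ⟨Q, ⟨hQ, hQ0⟩, hm⟩ := (measure fun P : DiffOp C => P.natDegree).wf.has_min s hs
  exact ⟨Q, hQ, hQ0, fun P hP hP0 => not_lt.1 (hm P ⟨hP, hP0⟩)⟩

/-- Remainders of right division by `Q` represent all classes. The finiteness feeds the dimension
count behind the existence of symmetric products. -/
theorem finite_quotient_principal (Q : DiffOp C) (hQ : Q ≠ 0) :
    Module.Finite (RatFunc C) (DiffOp C ⧸ principal Q) := by
  let φ := (principal Q).mkQ.comp (Polynomial.degreeLT (RatFunc C) Q.natDegree).subtype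
  refine Module.Finite.of_surjective φ fun y => ?_
  obtain ⟨P, rfl⟩ := (principal Q).mkQ_surjective y
  obtain ⟨R, S, h, hS⟩ := exists_mul_add Q hQ P
  refine ⟨⟨S, Polynomial.mem_degreeLT.2 (hS.trans_eq (Polynomial.degree_eq_natDegree hQ))⟩, ?_⟩
  simp only [φ, LinearMap.comp_apply, Submodule.mkQ_apply, Submodule.subtype_apply]
  rw [Submodule.Quotient.eq]
  refine (principal Q).neg_mem_iff.1 ⟨R, ?_⟩
  rw [h, mul_eq_opAct]; abel

/-- Multiplication by a nonzero rational function does not change the left ideal. -/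
theorem principal_smul (Q : DiffOp C) {a : RatFunc C} (ha : a ≠ 0) :
    principal (a • Q) = principal Q := by
  apply le_antisymm
  · exact (isLeftIdeal_principal Q).principal_le ((principal Q).smul_mem a (self_mem_principal Q))
  · refine (isLeftIdeal_principal _).principal_le ?_
    have := (principal (a • Q)).smul_mem a⁻¹ (self_mem_principal (a • Q))
    rwa [smul_smul, inv_mul_cancel₀ ha, one_smul] at this

end LeftIdeal

/-! ### Expansion of operators along the solutions of a fixed operator -/

section Expansion

/-- The connection on families of operators that corresponds to differentiating
`∑ f⁽ⁱ⁾ (Aᵢ · g)` when `L · f = 0`. -/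
def expansionD (L : DiffOp C) : (ℕ → DiffOp C) →+ (ℕ → DiffOp C) where
  toFun A i := leftDHom (A i) + (if i = 0 then 0 else A (i - 1)) -
    (L.coeff i / L.leadingCoeff) • A (L.natDegree - 1)
  map_zero' := by ext i : 1; simp
  map_add' A B := by
    ext i : 1
    simp only [Pi.add_apply, map_add, smul_add]
    split_ifs <;> abel

theorem expansionD_apply (L : DiffOp C) (A : ℕ → DiffOp C) (i : ℕ) :
    expansionD L A i = leftDHom (A i) + (if i = 0 then 0 else A (i - 1)) -
      (L.coeff i / L.leadingCoeff) • A (L.natDegree - 1) := rfl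

/-- The operators `Aᵢ` with `P · (f g) = ∑ f⁽ⁱ⁾ (Aᵢ · g)` whenever `L · f = 0`. -/
def expansion (L : DiffOp C) : DiffOp C →ₗ[RatFunc C] (ℕ → DiffOp C) :=
  opAct (expansionD L) (Pi.single 0 1)

variable {F : Type u} [CommRing F] [Differential F] [Algebra (RatFunc C) F]

/-- The value `∑ f⁽ⁱ⁾ (Aᵢ · g)`. -/
def evalPair (n : ℕ) (f g : F) : (ℕ → DiffOp C) →ₗ[RatFunc C] F where
  toFun A := ∑ i ∈ Finset.range n, (fun g : F => g′)^[i] f * (A i).act g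
  map_add' A B := by
    simp only [Pi.add_apply, act_add, mul_add, Finset.sum_add_distrib]
  map_smul' a A := by
    simp only [Pi.smul_apply, act_smul, RingHom.id_apply]
    rw [Algebra.smul_def, Finset.mul_sum]
    exact Finset.sum_congr rfl fun i _ => by ring

theorem evalPair_apply (n : ℕ) (f g : F) (A : ℕ → DiffOp C) :
    evalPair n f g A = ∑ i ∈ Finset.range n, (fun g : F => g′)^[i] f * (A i).act g := rfl

theorem iterate_deriv_natDegree (L : DiffOp C) (hL : L ≠ 0) {f : F} (hf : L.act f = 0) :
    (fun g : F => g′)^[L.natDegree] f = -∑ i ∈ Finset.range L.natDegree,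
      algebraMap (RatFunc C) F (L.coeff i / L.leadingCoeff) * (fun g : F => g′)^[i] f := by
  have h0 : L.leadingCoeff ≠ 0 := by simpa using hL
  have h : ((L.leadingCoeff)⁻¹ • L).act f = 0 := by rw [act_smul, hf, mul_zero]
  rw [act_eq_sum_range _ (n := L.natDegree + 1)
    ((Polynomial.natDegree_smul_le _ _).trans_lt (Nat.lt_succ_self _)), Finset.sum_range_succ] at h
  simp only [Polynomial.coeff_smul, smul_eq_mul] at h
  rw [Polynomial.coeff_natDegree, inv_mul_cancel₀ h0, map_one, one_mul, add_comm] at h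
  rw [eq_neg_of_add_eq_zero_left h]
  simp only [div_eq_inv_mul]

variable [DifferentialAlgebra (RatFunc C) F]

/-- Differentiating `∑ f⁽ⁱ⁾ (Aᵢ · g)` shifts the index on `f` or multiplies `Aᵢ` by `D`; the only
term leaving the range, `f⁽ʳ⁾ (A_{r-1} · g)`, is rewritten with `L · f = 0`. -/
theorem evalPair_expansionD (L : DiffOp C) (hL : 0 < L.natDegree) {f : F} (hf : L.act f = 0)
    (g : F) (A : ℕ → DiffOp C) :
    evalPair L.natDegree f g (expansionD L A) = derivHom F (evalPair L.natDegree f g A) := by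
  have hL0 : L ≠ 0 := by rintro rfl; simp at hL
  have hD : (derivHom F) (evalPair L.natDegree f g A) =
      (∑ i ∈ Finset.range L.natDegree, (fun g : F => g′)^[i + 1] f * (A i).act g) +
      ∑ i ∈ Finset.range L.natDegree, (fun g : F => g′)^[i] f * (leftDHom (A i)).act g := by
    rw [evalPair_apply, map_sum, ← Finset.sum_add_distrib]
    refine Finset.sum_congr rfl fun i _ => ?_
    rw [derivHom_apply, Derivation.leibniz, leftDHom_apply, act_leftD,
      Function.iterate_succ_apply', smul_eq_mul, smul_eq_mul]
    ring
  rw [hD]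
  obtain ⟨r, hr⟩ : ∃ r, L.natDegree = r + 1 := ⟨L.natDegree - 1, by omega⟩
  have hS : (∑ i ∈ Finset.range L.natDegree, (fun g : F => g′)^[i + 1] f * (A i).act g) =
      (∑ i ∈ Finset.range L.natDegree, (fun g : F => g′)^[i] f *
        (if i = 0 then 0 else A (i - 1) : DiffOp C).act g) -
      ∑ i ∈ Finset.range L.natDegree, (fun g : F => g′)^[i] f *
        ((L.coeff i / L.leadingCoeff) • A (L.natDegree - 1)).act g := by
    have h1 : ∑ i ∈ Finset.range L.natDegree, (fun g : F => g′)^[i] f *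
        ((L.coeff i / L.leadingCoeff) • A (L.natDegree - 1)).act g =
        - ((fun g : F => g′)^[L.natDegree] f * (A (L.natDegree - 1)).act g) := by
      rw [iterate_deriv_natDegree L hL0 hf, neg_mul, neg_neg, Finset.sum_mul]
      refine Finset.sum_congr rfl fun i _ => ?_
      rw [act_smul]; ring
    rw [h1, sub_neg_eq_add]
    simp only [hr]
    rw [Finset.sum_range_succ, Finset.sum_range_succ' (fun i => (fun g : F => g′)^[i] f *
        (if i = 0 then 0 else A (i - 1) : DiffOp C).act g)]
    simp [act_zero_left]
  rw [hS, evalPair_apply, sub_add_eq_add_sub, ← Finset.sum_add_distrib, ← Finset.sum_sub_distrib]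
  refine Finset.sum_congr rfl fun i _ => ?_
  rw [expansionD_apply, act_sub, act_add]; ring

/-- `P · (f g) = ∑ f⁽ⁱ⁾ (Aᵢ · g)`. -/
theorem act_mul_eq_expansion (L : DiffOp C) (hL : 0 < L.natDegree) {f : F} (hf : L.act f = 0)
    (g : F) (P : DiffOp C) :
    P.act (f * g) = ∑ i ∈ Finset.range L.natDegree,
      (fun g : F => g′)^[i] f * (expansion L P i).act g := by
  have h := map_opAct (evalPair L.natDegree f g)
    (fun A => evalPair_expansionD L hL hf g A) (Pi.single 0 1) P
  have h0 : evalPair L.natDegree f g (Pi.single 0 1 : ℕ → DiffOp C) = f * g := by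
    rw [evalPair_apply, Finset.sum_eq_single_of_mem 0 (Finset.mem_range.2 hL)]
    · simp [act_one]
    · intro i _ hi
      rw [Pi.single_eq_of_ne hi, act_zero_left, mul_zero]
  rw [h0, ← act_eq_opAct] at h
  exact h.symm

end Expansion

/-! ### Symmetric products -/

section SymProd

/-- The left ideal of the operators that annihilate all products. -/
def prodAnnihilator (L₁ L₂ : DiffOp C) : Submodule (RatFunc C) (DiffOp C) where
  carrier := {P | AnnihilatesProducts L₁ L₂ P}
  zero_mem' := by intro F _ _ _ _ f g _ _; exact act_zero_left _
  add_mem' := by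
    intro P Q hP hQ F _ _ _ _ f g hf hg
    rw [act_add, hP F f g hf hg, hQ F f g hf hg, add_zero]
  smul_mem' := by
    intro a P hP F _ _ _ _ f g hf hg
    rw [act_smul, hP F f g hf hg, mul_zero]

theorem isLeftIdeal_prodAnnihilator (L₁ L₂ : DiffOp C) : IsLeftIdeal (prodAnnihilator L₁ L₂) := by
  intro P hP F _ _ _ _ f g hf hg
  rw [act_leftD, hP F f g hf hg, map_zero]

theorem annihilatesProducts_of_expansion_mem {L Q P : DiffOp C} (hL : 0 < L.natDegree)
    (h : ∀ i < L.natDegree, expansion L P i ∈ principal Q) : AnnihilatesProducts L Q P := by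
  intro F _ _ _ _ f g hf hg
  rw [act_mul_eq_expansion L hL hf]
  refine Finset.sum_eq_zero fun i hi => ?_
  obtain ⟨R, hR⟩ := h i (Finset.mem_range.1 hi)
  rw [← hR, ← mul_eq_opAct, act_mul, hg, act_zero, mul_zero]

/-- Sending an operator to the residues modulo `Q` of its expansion is a linear map from an
infinite-dimensional to a finite-dimensional space over `C(x)`, so it has a kernel. -/
theorem prodAnnihilator_ne_bot {L Q : DiffOp C} (hL : 0 < L.natDegree) (hQ : Q ≠ 0) :
    prodAnnihilator L Q ≠ ⊥ := by
  let φ : DiffOp C →ₗ[RatFunc C] (Fin L.natDegree → DiffOp C ⧸ principal Q) :=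
    LinearMap.pi fun i => (principal Q).mkQ ∘ₗ LinearMap.proj (i : ℕ) ∘ₗ expansion L
  have := finite_quotient_principal Q hQ
  have hker : LinearMap.ker φ ≠ ⊥ := by
    intro h
    have := Module.Finite.of_injective φ (LinearMap.ker_eq_bot.1 h)
    exact Polynomial.not_finite this
  obtain ⟨P, hP, hP0⟩ := (Submodule.ne_bot_iff _).1 hker
  refine (Submodule.ne_bot_iff _).2 ⟨P, annihilatesProducts_of_expansion_mem hL fun i hi => ?_, hP0⟩
  have := congrFun (LinearMap.mem_ker.1 hP) ⟨i, hi⟩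
  simpa [φ, Submodule.Quotient.mk_eq_zero] using this

theorem IsPrimitiveOp.ne_zero {Q : DiffOp C} (h : IsPrimitiveOp Q) : Q ≠ 0 := by
  obtain ⟨q, rfl, hq, -⟩ := h
  rw [Ne, Polynomial.map_eq_zero_iff (RatFunc.algebraMap_injective C)]
  exact hq.ne_zero

/-- Clear denominators, divide by the content, and scale by a constant to make the leading
polynomial monic. -/
theorem exists_isPrimitiveOp_smul (Q : DiffOp C) (hQ : Q ≠ 0) :
    ∃ a : RatFunc C, a ≠ 0 ∧ IsPrimitiveOp (a • Q) := by
  let := Classical.choice (inferInstance : Nonempty (NormalizedGCDMonoid C[X]))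
  obtain ⟨b, hbm, hb⟩ := IsLocalization.integerNormalization_spec (nonZeroDivisors C[X]) Q
  set g := IsLocalization.integerNormalization (nonZeroDivisors C[X]) Q
  have hb0 : b ≠ 0 := nonZeroDivisors.ne_zero hbm
  have hinj := RatFunc.algebraMap_injective C
  have hbK : algebraMap C[X] (RatFunc C) b ≠ 0 := RatFunc.algebraMap_ne_zero hb0
  have hgb : g.map (algebraMap C[X] (RatFunc C)) = algebraMap C[X] (RatFunc C) b • Q := by
    rw [hb, algebraMap_smul]
  have hg : g ≠ 0 := by
    intro h
    rw [h, Polynomial.map_zero, eq_comm, smul_eq_zero] at hgb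
    exact hgb.elim hbK hQ
  have hc : g.content ≠ 0 := by rwa [Ne, Polynomial.content_eq_zero_iff]
  have hl : g.primPart.leadingCoeff.leadingCoeff ≠ 0 := by
    simpa using g.isPrimitive_primPart.ne_zero
  set l := g.primPart.leadingCoeff.leadingCoeff
  have hu : IsUnit (Polynomial.C l⁻¹ : C[X]) := Polynomial.isUnit_C.2 (isUnit_iff_ne_zero.2 (inv_ne_zero hl))
  refine ⟨algebraMap C[X] (RatFunc C) (Polynomial.C l⁻¹) *
    ((algebraMap C[X] (RatFunc C) g.content)⁻¹ * algebraMap C[X] (RatFunc C) b), ?_,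
    Polynomial.C (Polynomial.C l⁻¹) * g.primPart, ?_, ?_, ?_⟩
  · exact mul_ne_zero (RatFunc.algebraMap_ne_zero hu.ne_zero)
      (mul_ne_zero (inv_ne_zero (RatFunc.algebraMap_ne_zero hc)) hbK)
  · rw [mul_smul, mul_smul, ← hgb]
    have hmap := congrArg (Polynomial.map (algebraMap C[X] (RatFunc C))) g.eq_C_content_mul_primPart
    rw [hmap]
    simp only [Polynomial.map_mul, Polynomial.map_C, Polynomial.smul_eq_C_mul]
    rw [← mul_assoc (Polynomial.C _⁻¹), ← Polynomial.C_mul,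
      inv_mul_cancel₀ (RatFunc.algebraMap_ne_zero hc), Polynomial.C_1, one_mul]
  · intro r hr
    rw [IsUnit.dvd_mul_left (hu.map Polynomial.C)] at hr
    exact g.isPrimitive_primPart r hr
  · rw [Polynomial.leadingCoeff_mul, Polynomial.leadingCoeff_C, Polynomial.Monic,
      Polynomial.leadingCoeff_mul, Polynomial.leadingCoeff_C, inv_mul_cancel₀ hl]

/-- Excludes the junk value 0 in the definition of `symProd`: an annihilator of least order exists
and can be made primitive. -/
theorem isSymProd_symProd {L Q : DiffOp C} (hL : 0 < L.natDegree) (hQ : Q ≠ 0) :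
    IsSymProd L Q (symProd L Q) := by
  have h : ∃ P, IsSymProd L Q P := by
    obtain ⟨P, hP, hP0, hmin⟩ := exists_minimal_natDegree (prodAnnihilator_ne_bot hL hQ)
    obtain ⟨a, ha, hprim⟩ := exists_isPrimitiveOp_smul P hP0
    refine ⟨a • P, hprim, (prodAnnihilator L Q).smul_mem a hP, fun P' h0 h' => ?_⟩
    exact (Polynomial.natDegree_smul_le _ _).trans (hmin P' h' h0)
  rw [symProd, dif_pos h]
  exact h.choose_spec

theorem symProd_ne_zero {L Q : DiffOp C} (hL : 0 < L.natDegree) (hQ : Q ≠ 0) :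
    symProd L Q ≠ 0 :=
  (isSymProd_symProd hL hQ).1.ne_zero

/-- `L ⊗ Q` is a right factor of `M` exactly when `M` annihilates the products. -/
theorem isRightFactor_symProd_iff {L Q : DiffOp C} (hL : 0 < L.natDegree) (hQ : Q ≠ 0)
    (M : DiffOp C) : IsRightFactor (symProd L Q) M ↔ AnnihilatesProducts L Q M := by
  obtain ⟨hprim, hann, hmin⟩ := isSymProd_symProd hL hQ
  rw [← mem_principal]
  constructor
  · exact fun h => (isLeftIdeal_prodAnnihilator L Q).principal_le hann h
  · exact fun h => (isLeftIdeal_prodAnnihilator L Q).le_principal hann hprim.ne_zero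
      (fun P hP hP0 => hmin P hP0 hP) h

theorem symPow_ne_zero {L : DiffOp C} (hL : 0 < L.natDegree) (s : ℕ) : symPow L s ≠ 0 := by
  induction s with
  | zero => exact Polynomial.X_ne_zero
  | succ s ih => exact symProd_ne_zero hL ih

end SymProd

/-! ### Wronskians -/

section Wronskian

variable [CharZero C]

theorem eq_C_of_deriv_eq_zero {f : LaurentSeries C} (hf : f′ = 0) :
    f = HahnSeries.C (f.coeff 0) := by
  ext n
  by_cases h : n = 0
  · simp [h, HahnSeries.C_apply]
  · rw [HahnSeries.C_apply, HahnSeries.coeff_single_of_ne h]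
    have := laurentDeriv_coeff f (n - 1)
    rw [← deriv_laurent, hf, sub_add_cancel, HahnSeries.coeff_zero, eq_comm, mul_eq_zero] at this
    exact this.resolve_left (by exact_mod_cast h)

omit [CharZero C] in
/-- The Wronskian vectors of linearly independent solutions are linearly independent, in a
differential field whose constants are those of `C`. -/
theorem linearIndependent_wronskian_of_const {F : Type u} [Field F] [Differential F]
    [Algebra (RatFunc C) F] [Module C F]
    (hconst : ∀ x : F, x′ = 0 → ∃ c : C, ∀ y : F, x * y = c • y)
    (P : DiffOp C) (hP : P ≠ 0) {ι : Type*}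
    {f : ι → F} (hf : LinearIndependent C f) (hPf : ∀ j, P.act (f j) = 0) :
    LinearIndependent F fun j => fun i : Fin P.natDegree => (fun g : F => g′)^[i] (f j) := by
  classical
  rw [linearIndependent_iff']
  intro s
  induction s using Finset.induction_on with
  | empty => simp
  | insert a s has ih =>
    intro g hg
    by_cases hga : g a = 0
    · rw [Finset.sum_insert has, hga, zero_smul, zero_add] at hg
      intro j hj
      rcases Finset.mem_insert.1 hj with rfl | hj
      · exact hga
      · exact ih g hg j hj
    exfalso
    -- Normalise the relation so that the coefficient at `a` is 1; its derivative then vanishes, and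
    -- differentiation yields a relation over the smaller set `s`.
    obtain ⟨b, hb⟩ : ∃ b : ι → F, ∀ j, b j = (g a)⁻¹ * g j := ⟨_, fun _ => rfl⟩
    have hba : b a = 1 := by rw [hb, inv_mul_cancel₀ hga]
    have h1 : ∀ i < P.natDegree, ∑ j ∈ insert a s, b j * (fun g : F => g′)^[i] (f j) = 0 := by
      intro i hi
      have := congrFun hg ⟨i, hi⟩
      simp only [Finset.sum_apply, Pi.smul_apply, smul_eq_mul, Pi.zero_apply] at this
      simp only [hb, mul_assoc, ← Finset.mul_sum, this, mul_zero]
    -- The equation `P · f = 0` extends the relation to one further derivative, which is what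
    -- remains to be subtracted after differentiating.
    have h2 : ∀ i ≤ P.natDegree, ∑ j ∈ insert a s, b j * (fun g : F => g′)^[i] (f j) = 0 := by
      intro i hi
      rcases hi.lt_or_eq with hi | rfl
      · exact h1 i hi
      have : ∀ j, b j * (fun g : F => g′)^[P.natDegree] (f j) =
          -∑ i ∈ Finset.range P.natDegree,
            algebraMap (RatFunc C) F (P.coeff i / P.leadingCoeff) *
              (b j * (fun g : F => g′)^[i] (f j)) := by
        intro j
        rw [iterate_deriv_natDegree P hP (hPf j), mul_neg, Finset.mul_sum]
        congr 1
        exact Finset.sum_congr rfl fun i _ => by ring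
      simp only [this]
      rw [Finset.sum_neg_distrib, Finset.sum_comm, neg_eq_zero]
      refine Finset.sum_eq_zero fun i hi => ?_
      rw [← Finset.mul_sum, h1 i (Finset.mem_range.1 hi), mul_zero]
    have h3 : ∀ i < P.natDegree, ∑ j ∈ s, (b j)′ * (fun g : F => g′)^[i] (f j) = 0 := by
      intro i hi
      have h4 := congrArg (derivHom F) (h1 i hi)
      rw [map_zero, map_sum] at h4
      simp only [derivHom_apply, Derivation.leibniz, smul_eq_mul, Finset.sum_add_distrib] at h4
      have h5 := h2 (i + 1) hi
      simp only [Function.iterate_succ_apply'] at h5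
      rw [h5, zero_add, Finset.sum_insert has, hba, Derivation.map_one_eq_zero, mul_zero,
        zero_add] at h4
      rw [← h4]
      exact Finset.sum_congr rfl fun j _ => mul_comm _ _
    -- Induction applies to the shorter relation, so all coefficients are constants, and the row of
    -- index 0 contradicts independence over `C`.
    have h6 : ∀ j ∈ insert a s, (b j)′ = 0 := by
      intro j hj
      rcases Finset.mem_insert.1 hj with rfl | hj
      · rw [hba, Derivation.map_one_eq_zero]
      refine ih (fun j => (b j)′) ?_ j hj
      ext1 i
      simpa only [Finset.sum_apply, Pi.smul_apply, smul_eq_mul, Pi.zero_apply] using h3 i i.2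
    have h7 : ∀ j, ∃ c : C, j ∈ insert a s → ∀ y : F, b j * y = c • y := fun j => by
      by_cases hj : j ∈ insert a s
      · obtain ⟨c, hc⟩ := hconst _ (h6 j hj)
        exact ⟨c, fun _ => hc⟩
      · exact ⟨0, fun h => absurd h hj⟩
    choose c hc using h7
    have h8 : ∑ j ∈ insert a s, c j • f j = 0 := by
      rw [← h2 0 (Nat.zero_le _)]
      exact Finset.sum_congr rfl fun j hj => (hc j hj (f j)).symm
    have h9 := linearIndependent_iff'.1 hf _ _ h8 a (Finset.mem_insert_self _ _)
    have h10 := hc a (Finset.mem_insert_self _ _) (f a)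
    rw [h9, zero_smul, hba, one_mul] at h10
    exact hf.ne_zero a h10

theorem linearIndependent_wronskian (P : DiffOp C) (hP : P ≠ 0) {ι : Type*}
    {f : ι → LaurentSeries C} (hf : LinearIndependent C f) (hPf : ∀ j, P.act (f j) = 0) :
    LinearIndependent (LaurentSeries C) fun j => fun i : Fin P.natDegree =>
      (fun g : LaurentSeries C => g′)^[i] (f j) :=
  linearIndependent_wronskian_of_const (fun x hx => ⟨x.coeff 0, fun y => by
    conv_lhs => rw [eq_C_of_deriv_eq_zero hx]
    exact HahnSeries.C_mul_eq_smul⟩) P hP hf hPf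

theorem card_le_of_linearIndependent (P : DiffOp C) (hP : P ≠ 0) {ι : Type*} [Fintype ι]
    {f : ι → LaurentSeries C} (hf : LinearIndependent C f) (hPf : ∀ j, P.act (f j) = 0) :
    Fintype.card ι ≤ P.natDegree := by
  simpa using (linearIndependent_wronskian P hP hf hPf).fintype_card_le_finrank

omit [CharZero C] in
theorem mem_solutionSpace {P : DiffOp C} {f : LaurentSeries C} :
    f ∈ solutionSpace P ↔ P.act f = 0 := Iff.rfl

theorem rank_solutionSpace_le (P : DiffOp C) (hP : P ≠ 0) :
    Module.rank C (solutionSpace P) ≤ P.natDegree := by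
  refine rank_le fun s hs => ?_
  have := card_le_of_linearIndependent P hP
    (hs.map' (solutionSpace P).subtype (Submodule.ker_subtype _)) (fun j => j.1.2)
  simpa using this

theorem finite_solutionSpace (P : DiffOp C) (hP : P ≠ 0) : Module.Finite C (solutionSpace P) :=
  Module.rank_lt_aleph0_iff.1 ((rank_solutionSpace_le P hP).trans_lt (Cardinal.natCast_lt_aleph0))

theorem finrank_solutionSpace_le (P : DiffOp C) (hP : P ≠ 0) :
    Module.finrank C (solutionSpace P) ≤ P.natDegree :=
  Module.finrank_le_of_rank_le (rank_solutionSpace_le P hP)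

/-- The Wronskian matrix of a full system of solutions is invertible. -/
theorem eq_zero_of_wronskian (L : DiffOp C) (hL : L ≠ 0) {f : Fin L.natDegree → LaurentSeries C}
    (hf : LinearIndependent C f) (hLf : ∀ j, L.act (f j) = 0) {A : ℕ → LaurentSeries C}
    (h : ∀ j, ∑ i ∈ Finset.range L.natDegree,
      (fun g : LaurentSeries C => g′)^[i] (f j) * A i = 0) {i : ℕ} (hi : i < L.natDegree) :
    A i = 0 := by
  let W : Matrix (Fin L.natDegree) (Fin L.natDegree) (LaurentSeries C) :=
    fun j i => (fun g : LaurentSeries C => g′)^[i] (f j)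
  have hW : IsUnit W := Matrix.linearIndependent_rows_iff_isUnit.1
    (linearIndependent_wronskian L hL hf hLf)
  have hz : W.mulVec (fun i => A i) = 0 := by
    ext1 j
    have := h j
    rw [Finset.sum_range] at this
    exact this
  have := Matrix.mulVec_injective_iff_isUnit.2 hW (hz.trans (Matrix.mulVec_zero W).symm)
  exact congrFun this ⟨i, hi⟩

end Wronskian

/-! ### Orders of vanishing -/

section BigO

theorem IsBigOX.mono {f : LaurentSeries C} {m n : ℤ} (hf : IsBigOX f m) (h : n ≤ m) :
    IsBigOX f n := fun i hi => hf i (hi.trans_le h)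

theorem IsBigOX.add {f g : LaurentSeries C} {m : ℤ} (hf : IsBigOX f m) (hg : IsBigOX g m) :
    IsBigOX (f + g) m := fun i hi => by rw [HahnSeries.coeff_add, hf i hi, hg i hi, add_zero]

theorem IsBigOX.sub {f g : LaurentSeries C} {m : ℤ} (hf : IsBigOX f m) (hg : IsBigOX g m) :
    IsBigOX (f - g) m := fun i hi => by rw [HahnSeries.coeff_sub, hf i hi, hg i hi, sub_zero]

theorem isBigOX_zero (m : ℤ) : IsBigOX (0 : LaurentSeries C) m := fun _ _ => rfl

theorem IsBigOX.smul {f : LaurentSeries C} {m : ℤ} (hf : IsBigOX f m) (c : C) :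
    IsBigOX (c • f) m := fun i hi => by rw [HahnSeries.coeff_smul, hf i hi, smul_zero]

/-- The subspace of the series that vanish to order `m`. -/
def bigOX (C : Type u) [Field C] (m : ℤ) : Submodule C (LaurentSeries C) where
  carrier := {f | IsBigOX f m}
  zero_mem' := isBigOX_zero m
  add_mem' := IsBigOX.add
  smul_mem' c _ hf := hf.smul c

theorem isBigOX_order (f : LaurentSeries C) : IsBigOX f f.order :=
  fun _ hi => HahnSeries.coeff_eq_zero_of_lt_order hi

theorem IsBigOX.le_order {f : LaurentSeries C} {m : ℤ} (hf : IsBigOX f m) (h0 : f ≠ 0) :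
    m ≤ f.order := by
  by_contra h
  exact HahnSeries.coeff_order_eq_zero.not.2 h0 (hf _ (not_le.1 h))

theorem IsBigOX.mul {f g : LaurentSeries C} {m n : ℤ} (hf : IsBigOX f m) (hg : IsBigOX g n) :
    IsBigOX (f * g) (m + n) := by
  intro i hi
  rw [HahnSeries.coeff_mul]
  refine Finset.sum_eq_zero fun ij hij => ?_
  have h : ij.1 + ij.2 = i := (Finset.mem_antidiagonal.mp hij).2.2
  rcases lt_or_ge ij.1 m with h1 | h1
  · rw [hf _ h1, zero_mul]
  · rw [hg ij.2 (by omega), mul_zero]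

theorem IsBigOX.coeff_mul {f g : LaurentSeries C} {m n : ℤ} (hf : IsBigOX f m)
    (hg : IsBigOX g n) : (f * g).coeff (m + n) = f.coeff m * g.coeff n := by
  rw [HahnSeries.coeff_mul]
  refine (Finset.sum_eq_single (m, n) (fun ij hij hne => ?_) fun h => ?_)
  · have h : ij.1 + ij.2 = m + n := (Finset.mem_antidiagonal.mp hij).2.2
    rcases lt_or_ge ij.1 m with h1 | h1
    · rw [hf _ h1, zero_mul]
    · rcases h1.lt_or_eq with h1 | h1
      · rw [hg ij.2 (by omega), mul_zero]
      · exact absurd (Prod.ext h1.symm (by simp only; omega)) hne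
  · by_contra h0
    refine h (Finset.mem_antidiagonal.mpr ⟨?_, ?_, rfl⟩)
    · exact left_ne_zero_of_mul h0
    · exact right_ne_zero_of_mul h0

theorem iterate_deriv_coeff (i : ℕ) (f : LaurentSeries C) (n : ℤ) :
    ((fun g : LaurentSeries C => g′)^[i] f).coeff n =
      (((descPochhammer ℤ i).eval (n + i) : ℤ) : C) * f.coeff (n + i) := by
  have := LaurentSeries.derivative_iterate_coeff (R := C) i f n
  rw [zsmul_eq_mul, ← Polynomial.eval_eq_smeval] at this
  exact this

theorem IsBigOX.iterate_deriv {f : LaurentSeries C} {m : ℤ} (hf : IsBigOX f m) (i : ℕ) :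
    IsBigOX ((fun g : LaurentSeries C => g′)^[i] f) (m - i) := by
  intro n hn
  rw [iterate_deriv_coeff, hf _ (by omega), mul_zero]

/-- Sharper than `IsBigOX.iterate_deriv` at order 0: the would-be coefficient at `x⁻¹` carries the
factor 0. -/
theorem IsBigOX.iterate_deriv_zero {f : LaurentSeries C} (hf : IsBigOX f 0) (i : ℕ) :
    IsBigOX ((fun g : LaurentSeries C => g′)^[i] f) 0 := by
  induction i with
  | zero => exact hf
  | succ i ih =>
    intro n hn
    rw [Function.iterate_succ_apply', deriv_laurent, laurentDeriv_coeff]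
    rcases (show n + 1 ≤ 0 by omega).lt_or_eq with h | h
    · rw [ih _ h, mul_zero]
    · rw [h, Int.cast_zero, zero_mul]

theorem coeff_algebraMap_polynomial (p : C[X]) (n : ℕ) :
    (algebraMap C[X] (LaurentSeries C) p).coeff n = p.coeff n := by
  rw [HahnSeries.algebraMap_apply']
  have : algebraMap C[X] (PowerSeries C) p = (p : PowerSeries C) := rfl
  rw [this]
  exact (LaurentSeries.coeff_coe_powerSeries _ n).trans (by simp)

theorem isBigOX_algebraMap_polynomial (p : C[X]) :
    IsBigOX (algebraMap C[X] (LaurentSeries C) p) 0 := by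
  intro n hn
  rw [HahnSeries.algebraMap_apply', PowerSeries.coeff_coe, if_pos hn]

/-- If the expansion had a pole, its lowest coefficient times the nonzero constant term of the
denominator would be a polar coefficient of the numerator. -/
theorem isBigOX_of_denom (a : RatFunc C) (ha : a.denom.eval 0 ≠ 0) :
    IsBigOX (algebraMap (RatFunc C) (LaurentSeries C) a) 0 := by
  set y := algebraMap (RatFunc C) (LaurentSeries C) a with hy
  by_cases hy0 : y = 0
  · rw [hy0]; exact isBigOX_zero 0
  have hmul : y * algebraMap C[X] (LaurentSeries C) a.denom =
      algebraMap C[X] (LaurentSeries C) a.num := by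
    have h0 : algebraMap C[X] (LaurentSeries C) a.denom ≠ 0 := fun h => a.denom_ne_zero
      (FaithfulSMul.algebraMap_injective C[X] (LaurentSeries C) (by rw [h, map_zero]))
    rw [hy]
    have h1 := congrArg (algebraMap (RatFunc C) (LaurentSeries C)) a.num_div_denom
    rw [RatFunc.algebraMap_apply_div] at h1
    rw [← h1, div_mul_cancel₀ _ h0]
  refine (isBigOX_order y).mono ?_
  by_contra hlt
  have h1 := (isBigOX_order y).coeff_mul (isBigOX_algebraMap_polynomial a.denom)
  rw [hmul, isBigOX_algebraMap_polynomial _ _ (by omega)] at h1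
  have h2 := coeff_algebraMap_polynomial a.denom 0
  rw [Nat.cast_zero] at h2
  rw [h2, Polynomial.coeff_zero_eq_eval_zero] at h1
  exact mul_ne_zero (HahnSeries.coeff_order_eq_zero.not.2 hy0) ha h1.symm

theorem isBigOX_sum {ι : Type*} (s : Finset ι) (f : ι → LaurentSeries C) {m : ℤ}
    (h : ∀ i ∈ s, IsBigOX (f i) m) : IsBigOX (∑ i ∈ s, f i) m :=
  (bigOX C m).sum_mem h

/-- An operator of order at most `δ` with coefficients regular at `0` lowers the order of vanishing
by at most `δ`. -/
theorem isBigOX_act {P : DiffOp C} {δ : ℕ} (hδ : P.natDegree ≤ δ)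
    (hP : ∀ i, IsBigOX (algebraMap (RatFunc C) (LaurentSeries C) (P.coeff i)) 0)
    {f : LaurentSeries C} {m : ℤ} (hf : IsBigOX f m) : IsBigOX (P.act f) (m - δ) := by
  rw [act_eq_sum_range P (Nat.lt_succ_of_le hδ)]
  refine isBigOX_sum _ _ fun i hi => ?_
  have := Finset.mem_range.1 hi
  exact ((hP i).mul (hf.iterate_deriv i)).mono (by omega)

end BigO

/-! ### Indicial polynomials -/

section Indicial

variable [CharZero C]

-- The lowest shift is `σ = min (ord aᵢ - i)`, and the terms attaining it contribute multiples of
-- falling factorials, whose linear independence makes `p` nonzero. The claim covers arbitrary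
-- Laurent series rather than only `x^s`, so that it applies to solutions.
omit [CharZero C] in
theorem exists_indicial (N : DiffOp C) (hN : N ≠ 0) : ∃ (p : C[X]) (σ : ℤ), p ≠ 0 ∧
    ∀ (f : LaurentSeries C) (v : ℤ), IsBigOX f v → IsBigOX (N.act f) (v + σ) ∧
      (N.act f).coeff (v + σ) = p.eval (v : C) * f.coeff v := by
  set a : ℕ → LaurentSeries C := fun i => algebraMap (RatFunc C) (LaurentSeries C) (N.coeff i)
    with ha
  have hne : N.support.Nonempty := Polynomial.nonempty_support_iff.2 hN
  obtain ⟨i₀, hi₀, hmin⟩ := N.support.exists_min_image (fun i => (a i).order - i) hne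
  set σ := (a i₀).order - i₀ with hσ
  have hO : ∀ i, IsBigOX (a i) (σ + i) := by
    intro i
    by_cases hi : i ∈ N.support
    · exact (isBigOX_order _).mono (by have := hmin i hi; omega)
    · rw [Polynomial.notMem_support_iff] at hi
      simp only [ha, hi, map_zero]
      exact isBigOX_zero _
  let S : Polynomial.Sequence C := ⟨descPochhammer C, fun i => by
    rw [Polynomial.degree_eq_natDegree (monic_descPochhammer C i).ne_zero,
      descPochhammer_natDegree]⟩
  refine ⟨∑ i ∈ Finset.range (N.natDegree + 1), (a i).coeff (σ + i) • descPochhammer C i, σ, ?_, ?_⟩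
  · intro h
    have hli : LinearIndependent C (fun i => descPochhammer C i) := S.linearIndependent
    have h1 := linearIndependent_iff'.1 hli _ _ h i₀
      (Finset.mem_range.2 (Nat.lt_succ_of_le (Polynomial.le_natDegree_of_mem_supp _ hi₀)))
    rw [hσ, sub_add_cancel, HahnSeries.coeff_order_eq_zero] at h1
    rw [Polynomial.mem_support_iff] at hi₀
    exact hi₀ ((map_eq_zero _).1 h1)
  · intro f v hf
    have hterm : ∀ i, IsBigOX (a i * (fun g : LaurentSeries C => g′)^[i] f) (v + σ) ∧
        (a i * (fun g : LaurentSeries C => g′)^[i] f).coeff (v + σ) =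
          (a i).coeff (σ + i) * (((descPochhammer ℤ i).eval v : ℤ) : C) * f.coeff v := by
      intro i
      have h1 := (hO i).mul (hf.iterate_deriv i)
      have h2 := (hO i).coeff_mul (hf.iterate_deriv i)
      have h3 : σ + i + (v - i) = v + σ := by ring
      rw [h3] at h1 h2
      rw [iterate_deriv_coeff, sub_add_cancel, ← mul_assoc] at h2
      exact ⟨h1, h2⟩
    rw [act_eq_sum_range N (Nat.lt_succ_self _)]
    refine ⟨isBigOX_sum _ _ fun i _ => (hterm i).1, ?_⟩
    rw [HahnSeries.coeff_sum, Polynomial.eval_finsetSum, Finset.sum_mul]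
    refine Finset.sum_congr rfl fun i _ => ?_
    rw [(hterm i).2, Polynomial.eval_smul, smul_eq_mul, ← descPochhammer_map (Int.castRingHom C) i,
      Polynomial.eval_intCast_map]
    simp

/-- Different shifts would make one polynomial vanish at all natural numbers; equal shifts make the
two agree there. In characteristic zero these are infinitely many points. -/
theorem IsIndicialPoly.unique {N : DiffOp C} {p q : C[X]} (hp : IsIndicialPoly N p)
    (hq : IsIndicialPoly N q) : p = q := by
  obtain ⟨hp0, σ, hσ⟩ := hp
  obtain ⟨hq0, τ, hτ⟩ := hq
  have hinf : ∀ p q : C[X], (∀ s : ℕ, p.eval (s : C) = q.eval (s : C)) → p = q := fun p q h =>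
    Polynomial.eq_of_infinite_eval_eq p q
      ((Set.infinite_range_of_injective (Nat.cast_injective (R := C))).mono
        (by rintro _ ⟨s, rfl⟩; exact h s))
  rcases lt_trichotomy σ τ with h | h | h
  · exact absurd (hinf p 0 fun s => by
      rw [← (hσ s).2, (hτ s).1 _ (by omega), Polynomial.eval_zero]) hp0
  · subst h
    exact hinf p q fun s => by rw [← (hσ s).2, (hτ s).2]
  · exact absurd (hinf q 0 fun s => by
      rw [← (hτ s).2, (hσ s).1 _ (by omega), Polynomial.eval_zero]) hq0

omit [CharZero C] in
/-- The order of a nonzero power series solution is an indicial root. -/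
theorem mem_indicialRoots {N : DiffOp C} (hN : N ≠ 0) {f : LaurentSeries C} (hf : N.act f = 0)
    {v : ℕ} (hv : IsBigOX f v) (hv0 : f.coeff v ≠ 0) : v ∈ indicialRoots N := by
  obtain ⟨p, σ, hp, h⟩ := exists_indicial N hN
  refine ⟨p, ⟨hp, σ, fun s => ?_⟩, ?_⟩
  · have hs : IsBigOX (HahnSeries.single (s : ℤ) (1 : C) : LaurentSeries C) s :=
      fun n hn => HahnSeries.coeff_single_of_ne (by omega)
    refine ⟨(h _ _ hs).1, ?_⟩
    rw [(h _ _ hs).2, HahnSeries.coeff_single_same, mul_one, Int.cast_natCast]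
  · have := (h f v hv).2
    rw [hf, HahnSeries.coeff_zero, eq_comm, mul_eq_zero, Int.cast_natCast] at this
    exact this.resolve_right hv0

theorem exists_isGreatest_indicialRoots {N : DiffOp C} (h : (indicialRoots N).Nonempty) :
    ∃ z, IsGreatest (indicialRoots N) z := by
  classical
  obtain ⟨k, p, hp, hk⟩ := h
  have hsub : indicialRoots N ⊆ (fun n : ℕ => (n : C)) ⁻¹' (p.roots.toFinset : Set C) := by
    rintro n ⟨q, hq, hn⟩
    rw [hq.unique hp] at hn
    simpa [hp.1] using hn
  have hfin : (indicialRoots N).Finite :=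
    (Set.Finite.preimage Nat.cast_injective.injOn (Finset.finite_toSet _)).subset hsub
  have hne : hfin.toFinset.Nonempty := ⟨k, hfin.mem_toFinset.2 ⟨p, hp, hk⟩⟩
  refine ⟨hfin.toFinset.max' hne, hfin.mem_toFinset.1 (Finset.max'_mem _ hne), fun n hn => ?_⟩
  exact Finset.le_max' _ _ (hfin.mem_toFinset.2 hn)

end Indicial

/-! ### Solutions at an ordinary point -/

section Ordinary

/-- All coefficients of the monic multiple of `L` are power series. -/
def IsRegularOp (L : DiffOp C) : Prop :=
  ∀ i, IsBigOX (algebraMap (RatFunc C) (LaurentSeries C) (L.coeff i / L.leadingCoeff)) 0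

theorem IsOrdinaryAtZero.isRegularOp {L : DiffOp C} (h : IsOrdinaryAtZero L) : IsRegularOp L :=
  fun i => isBigOX_of_denom _ (h.2 i)

/-- Well-founded recursion for a rule whose value at `n` depends only on earlier terms; terms not
yet defined are filled with 0, which causality makes harmless. -/
theorem exists_eq_of_causal {A : Type*} [Zero A] (φ : (ℕ → A) → ℕ → A)
    (hφ : ∀ n c c', (∀ m < n, c m = c' m) → φ c n = φ c' n) : ∃ c, ∀ n, c n = φ c n := by
  let F : (n : ℕ) → ((m : ℕ) → m < n → A) → A :=
    fun n ih => φ (fun m => if h : m < n then ih m h else 0) n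
  let c : ℕ → A := WellFounded.fix Nat.lt_wfRel.wf F
  refine ⟨c, fun n => ?_⟩
  have h1 : c n = F n fun m _ => c m := WellFounded.fix_eq _ _ _
  rw [h1]
  exact hφ _ _ _ fun m hm => by simp [hm]

variable [CharZero C]

/-- The coefficient of `x^(n-r)` in `D^r f + T f = 0` determines the `n`-th coefficient of `f` from
earlier ones, since its factor `n(n-1)⋯(n-r+1)` is nonzero for `n ≥ r` in characteristic zero. -/
theorem exists_solution {L : DiffOp C} (hL : L ≠ 0) (hreg : IsRegularOp L) (init : ℕ → C) :
    ∃ f : LaurentSeries C, L.act f = 0 ∧ IsBigOX f 0 ∧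
      ∀ n : ℕ, n < L.natDegree → f.coeff n = init n := by
  set r := L.natDegree with hr
  set a : ℕ → LaurentSeries C := fun i =>
    algebraMap (RatFunc C) (LaurentSeries C) (L.coeff i / L.leadingCoeff) with ha
  let S : (ℕ → C) → LaurentSeries C := fun c => HahnSeries.ofPowerSeries ℤ C (PowerSeries.mk c)
  have hScoeff : ∀ c (n : ℕ), (S c).coeff n = c n := fun c n => by
    simp only [S, LaurentSeries.coeff_coe_powerSeries, PowerSeries.coeff_mk]
  have hSO : ∀ c, IsBigOX (S c) 0 := fun c n hn => by
    simp only [S, PowerSeries.coeff_coe, if_pos hn]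
  let T : LaurentSeries C → LaurentSeries C := fun f =>
    ∑ i ∈ Finset.range r, a i * (fun g : LaurentSeries C => g′)^[i] f
  -- `T` contains at most `r - 1` derivatives, so it loses at most `r - 1` orders. This one spare
  -- order makes the recursion causal.
  have hT : ∀ f g (n : ℤ), IsBigOX (f - g) n → ∀ m : ℤ, m < n - r + 1 →
      (T f).coeff m = (T g).coeff m := by
    intro f g n h m hm
    have h1 : T f = T (f - g) + T g := by
      simp only [T, ← Finset.sum_add_distrib]
      refine Finset.sum_congr rfl fun i _ => ?_
      rw [← mul_add, ← iterate_deriv_add, sub_add_cancel]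
    have h2 : IsBigOX (T (f - g)) (n - r + 1) := by
      refine isBigOX_sum _ _ fun i hi => ?_
      have := Finset.mem_range.1 hi
      exact ((hreg i).mul (h.iterate_deriv i)).mono (by omega)
    rw [h1, HahnSeries.coeff_add, h2 m hm, zero_add]
  obtain ⟨c, hc⟩ := exists_eq_of_causal (A := C) (fun c n => if n < r then init n else
      -((((descPochhammer ℤ r).eval (n : ℤ) : ℤ) : C))⁻¹ * (T (S c)).coeff (n - r)) (by
    intro n c c' h
    split_ifs with hn
    · rfl
    · congr 1
      refine hT _ _ n (fun m hm => ?_) _ (by omega)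
      rcases lt_or_ge m 0 with h0 | h0
      · exact ((hSO c).sub (hSO c')) m h0
      · lift m to ℕ using h0
        rw [HahnSeries.coeff_sub, hScoeff, hScoeff, h m (by omega), sub_self])
  have hpoch : ∀ n : ℕ, r ≤ n → (((descPochhammer ℤ r).eval (n : ℤ) : ℤ) : C) ≠ 0 := by
    intro n hn
    rw [descPochhammer_eval_eq_descFactorial, Int.cast_natCast, Nat.cast_ne_zero]
    exact fun h => absurd (Nat.descFactorial_eq_zero_iff_lt.1 h) (by omega)
  have hD : (fun g : LaurentSeries C => g′)^[r] (S c) + T (S c) = 0 := by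
    ext n
    rw [HahnSeries.coeff_add, HahnSeries.coeff_zero, iterate_deriv_coeff]
    rcases lt_or_ge n 0 with h0 | h0
    · have h1 : IsBigOX (T (S c)) 0 := isBigOX_sum _ _ fun i _ => by
        simpa only [add_zero] using (hreg i).mul ((hSO c).iterate_deriv_zero i)
      rw [← iterate_deriv_coeff, (hSO c).iterate_deriv_zero r n h0, h1 n h0, add_zero]
    · lift n to ℕ using h0
      have h1 := hc (n + r)
      rw [if_neg (by omega)] at h1
      have h2 : ((n : ℤ) + (r : ℤ)) = ((n + r : ℕ) : ℤ) := by push_cast; ring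
      have h3 : (((n + r : ℕ) : ℤ) - (r : ℤ)) = n := by push_cast; ring
      rw [h3] at h1
      rw [h2, hScoeff, h1, neg_mul, mul_neg, mul_inv_cancel_left₀ (hpoch _ (by omega)),
        neg_add_cancel]
  refine ⟨S c, ?_, hSO c, fun n hn => ?_⟩
  · have h0 : L.leadingCoeff ≠ 0 := by simpa using hL
    have h1 : L.act (S c) = algebraMap (RatFunc C) (LaurentSeries C) L.leadingCoeff *
        ((fun g : LaurentSeries C => g′)^[r] (S c) + T (S c)) := by
      rw [act_eq_sum_range L (Nat.lt_succ_self _), Finset.sum_range_succ, ← hr, mul_add, add_comm,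
        Finset.mul_sum]
      congr 1
      refine Finset.sum_congr rfl fun i _ => ?_
      rw [ha, ← mul_assoc, ← map_mul, mul_div_cancel₀ _ h0]
    rw [h1, hD, mul_zero]
  · rw [hScoeff, hc, if_pos hn]

end Ordinary

/-! ### Full solution spaces at an ordinary point -/

section OrdinarySpace

variable [CharZero C]

/-- Take unit vectors as initial values. The resulting orders `0, 1, …, r-1` are what later produces
the shift `r(r-1)/2`. -/
theorem exists_solution_basis {L : DiffOp C} (hL : L ≠ 0) (hreg : IsRegularOp L) :
    ∃ f : Fin L.natDegree → LaurentSeries C, LinearIndependent C f ∧ (∀ j, L.act (f j) = 0) ∧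
      ∀ j, IsBigOX (f j) 0 ∧ IsBigOX (f j) (j : ℕ) ∧ (f j).coeff (j : ℕ) = 1 := by
  choose f hf h0 hc using fun j : Fin L.natDegree => exists_solution hL hreg (Pi.single (j : ℕ) 1)
  refine ⟨f, ?_, hf, fun j => ⟨h0 j, fun n hn => ?_, ?_⟩⟩
  · rw [Fintype.linearIndependent_iff]
    intro g hg i
    have := congrArg (fun h : LaurentSeries C => h.coeff ((i : ℕ) : ℤ)) hg
    simp only [HahnSeries.coeff_sum, HahnSeries.coeff_smul, HahnSeries.coeff_zero, hc _ _ i.2] at this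
    rw [Finset.sum_eq_single i] at this
    · simpa using this
    · intro b _ hb
      rw [Pi.single_eq_of_ne (fun h => hb (Fin.ext h.symm)), smul_zero]
    · simp
  · rcases lt_or_ge n 0 with h | h
    · exact h0 j n h
    · lift n to ℕ using h
      have hn' : n < j := by exact_mod_cast hn
      rw [hc j n (hn'.trans j.2), Pi.single_eq_of_ne hn'.ne]
  · rw [hc j _ j.2, Pi.single_eq_same]

theorem finrank_solutionSpace {L : DiffOp C} (hL : L ≠ 0) (hreg : IsRegularOp L) :
    Module.finrank C (solutionSpace L) = L.natDegree := by
  refine (finrank_solutionSpace_le L hL).antisymm ?_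
  obtain ⟨f, hf, hLf, -⟩ := exists_solution_basis hL hreg
  have := finite_solutionSpace L hL
  have h : LinearIndependent C fun j => (⟨f j, hLf j⟩ : solutionSpace L) :=
    LinearIndependent.of_comp (solutionSpace L).subtype hf
  simpa using h.fintype_card_le_finrank

/-- The power series solutions already fill the maximal possible dimension, so no solution has a
pole. -/
theorem solutionSpace_le_bigOX {L : DiffOp C} (hL : L ≠ 0) (hreg : IsRegularOp L) :
    solutionSpace L ≤ bigOX C 0 := by
  obtain ⟨f, hf, hLf, h⟩ := exists_solution_basis hL hreg
  have := finite_solutionSpace L hL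
  have h1 : Submodule.span C (Set.range f) ≤ solutionSpace L :=
    Submodule.span_le.2 (by rintro _ ⟨j, rfl⟩; exact hLf j)
  have h2 : Submodule.span C (Set.range f) = solutionSpace L :=
    Submodule.eq_of_le_of_finrank_eq h1 (by
      rw [finrank_span_eq_card hf, finrank_solutionSpace hL hreg, Fintype.card_fin])
  rw [← h2, Submodule.span_le]
  rintro _ ⟨j, rfl⟩
  exact (h j).1

end OrdinarySpace

/-! ### The leading part of the expansion -/

section ExpansionLead

theorem opAct_eq_sum_range {E : Type*} [AddCommGroup E] [Module (RatFunc C) E] (d : E →+ E)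
    (e : E) (P : DiffOp C) {n : ℕ} (hn : P.natDegree < n) :
    opAct d e P = ∑ i ∈ Finset.range n, P.coeff i • d^[i] e :=
  Polynomial.sum_over_range' P (by simp) n hn

/-- In the expansion of `Dⁿ(f g)` the factor of `f` is `Dⁿ` plus lower terms: reaching any other
component costs a derivative that falls on `f`, and reduction by `L` adds no order. -/
theorem degree_iterate_expansionD (L : DiffOp C) (n : ℕ) :
    (((expansionD L)^[n] (Pi.single 0 1) 0).degree = n ∧
      ((expansionD L)^[n] (Pi.single 0 1) 0).leadingCoeff = 1) ∧
      ∀ i, i ≠ 0 → ((expansionD L)^[n] (Pi.single 0 1) i).degree < n := by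
  induction n with
  | zero =>
    refine ⟨by simp, fun i hi => ?_⟩
    simp [Pi.single_eq_of_ne hi]
  | succ n ih =>
    obtain ⟨⟨h1, h2⟩, h3⟩ := ih
    rw [Function.iterate_succ_apply']
    set A := (expansionD L)^[n] (Pi.single 0 1)
    have hcast : ((n + 1 : ℕ) : WithBot ℕ) = n + 1 := by simp
    have hn1 : (n : WithBot ℕ) < ((n + 1 : ℕ) : WithBot ℕ) := by exact_mod_cast Nat.lt_succ_self n
    have hle : ∀ i, (A i).degree ≤ n := fun i => by
      by_cases hi : i = 0
      · rw [hi, h1]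
      · exact (h3 i hi).le
    have hsm : ∀ i, ((L.coeff i / L.leadingCoeff) • A (L.natDegree - 1)).degree <
        ((n + 1 : ℕ) : WithBot ℕ) := fun i =>
      ((Polynomial.degree_smul_le _ _).trans (hle _)).trans_lt hn1
    have hD : (leftDHom (A 0)).degree = ((n + 1 : ℕ) : WithBot ℕ) := by
      rw [leftDHom_apply, degree_leftD, h1, hcast]
    have h0 : expansionD L A 0 =
        leftDHom (A 0) - (L.coeff 0 / L.leadingCoeff) • A (L.natDegree - 1) := by
      rw [expansionD_apply, if_pos rfl, add_zero]
    refine ⟨⟨?_, ?_⟩, fun i hi => ?_⟩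
    · rw [h0, Polynomial.degree_sub_eq_left_of_degree_lt (by rw [hD]; exact hsm 0), hD]
    · rw [h0, Polynomial.leadingCoeff_sub_of_degree_lt (by rw [hD]; exact hsm 0), leftDHom_apply,
        leadingCoeff_leftD, h2]
    · rw [expansionD_apply, if_neg hi]
      refine (Polynomial.degree_sub_le _ _).trans_lt (max_lt ?_ (hsm i))
      refine (Polynomial.degree_add_le _ _).trans_lt (max_lt ?_ ((hle _).trans_lt hn1))
      rw [leftDHom_apply, degree_leftD, hcast]
      exact WithBot.add_lt_add_right (by simp) (h3 i hi)

theorem degree_sum_smul_monic {P : DiffOp C} (hP : P ≠ 0) {A : ℕ → DiffOp C}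
    (hA : ∀ n, (A n).degree = n ∧ (A n).leadingCoeff = 1) :
    (∑ n ∈ Finset.range (P.natDegree + 1), P.coeff n • A n).natDegree = P.natDegree ∧
    (∑ n ∈ Finset.range (P.natDegree + 1), P.coeff n • A n).leadingCoeff = P.leadingCoeff := by
  have hl : P.leadingCoeff ≠ 0 := by simpa using hP
  have h1 : (P.leadingCoeff • A P.natDegree).degree = P.natDegree := by
    rw [Polynomial.degree_smul_of_smul_regular _ (IsSMulRegular.of_ne_zero hl), (hA _).1]
  have h2 : (∑ n ∈ Finset.range P.natDegree, P.coeff n • A n).degree <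
      (P.leadingCoeff • A P.natDegree).degree := by
    rw [h1]
    refine (Polynomial.degree_sum_le _ _).trans_lt ?_
    rw [Finset.sup_lt_iff (WithBot.bot_lt_coe _)]
    intro i hi
    refine (Polynomial.degree_smul_le _ _).trans_lt ?_
    rw [(hA i).1]
    exact_mod_cast Finset.mem_range.1 hi
  rw [Finset.sum_range_succ, Polynomial.coeff_natDegree]
  refine ⟨Polynomial.natDegree_eq_of_degree_eq_some ?_, ?_⟩
  · rw [Polynomial.degree_add_eq_right_of_degree_lt h2, h1]
  · rw [Polynomial.leadingCoeff_add_of_degree_lt h2, Polynomial.smul_eq_C_mul,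
      Polynomial.leadingCoeff_mul, Polynomial.leadingCoeff_C, (hA _).2, mul_one]

theorem expansion_zero (L M : DiffOp C) : expansion L M 0 =
    ∑ n ∈ Finset.range (M.natDegree + 1), M.coeff n • (expansionD L)^[n] (Pi.single 0 1) 0 := by
  rw [expansion, opAct_eq_sum_range _ _ _ (Nat.lt_succ_self _), Finset.sum_apply]
  rfl

theorem expansion_zero_natDegree (L : DiffOp C) {M : DiffOp C} (hM : M ≠ 0) :
    (expansion L M 0).natDegree = M.natDegree ∧
      (expansion L M 0).leadingCoeff = M.leadingCoeff := by
  rw [expansion_zero]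
  exact degree_sum_smul_monic hM fun n => (degree_iterate_expansionD L n).1

theorem expansion_zero_ne_zero (L : DiffOp C) {M : DiffOp C} (hM : M ≠ 0) :
    expansion L M 0 ≠ 0 := by
  rw [← Polynomial.leadingCoeff_ne_zero, (expansion_zero_natDegree L hM).2,
    Polynomial.leadingCoeff_ne_zero]
  exact hM

/-- All these coefficients arise from the `ℓᵢ/ℓᵣ` by sums, products and derivatives, none of which
creates a pole at 0. -/
theorem isBigOX_iterate_expansionD {L : DiffOp C} (hL : IsRegularOp L) (n i j : ℕ) :
    IsBigOX (algebraMap (RatFunc C) (LaurentSeries C)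
      (((expansionD L)^[n] (Pi.single 0 1) i).coeff j)) 0 := by
  induction n generalizing i j with
  | zero =>
    rw [Function.iterate_zero_apply]
    have h1 : IsBigOX (1 : LaurentSeries C) 0 := fun n hn => by
      rw [HahnSeries.coeff_one, if_neg hn.ne]
    by_cases hi : i = 0
    · rw [hi, Pi.single_eq_same, Polynomial.coeff_one]
      split_ifs
      · rw [map_one]; exact h1
      · rw [map_zero]; exact isBigOX_zero 0
    · rw [Pi.single_eq_of_ne hi, Polynomial.coeff_zero, map_zero]; exact isBigOX_zero 0
  | succ n ih =>
    rw [Function.iterate_succ_apply']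
    set A := (expansionD L)^[n] (Pi.single 0 1)
    rw [expansionD_apply, Polynomial.coeff_sub, Polynomial.coeff_add, leftDHom_apply, DiffOp.leftD,
      Polynomial.coeff_add, Differential.coeff_mapCoeffs, Polynomial.coeff_smul, smul_eq_mul,
      map_sub, map_add, map_add, map_mul]
    refine IsBigOX.sub (IsBigOX.add (IsBigOX.add ?_ ?_) ?_) ?_
    · rcases j with _ | j
      · rw [Polynomial.coeff_X_mul_zero, map_zero]; exact isBigOX_zero 0
      · rw [Polynomial.coeff_X_mul]; exact ih i j
    · rw [← deriv_algebraMap]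
      exact (ih i j).iterate_deriv_zero 1
    · split_ifs
      · rw [Polynomial.coeff_zero, map_zero]; exact isBigOX_zero 0
      · exact ih _ _
    · simpa only [add_zero] using (hL i).mul (ih (L.natDegree - 1) j)

/-- Gives `A₀` a full solution space, the source of the dimension of the colon space. Sharing the
leading coefficient of `M` lets the quotients `mₙ/mᵣ` be used directly. -/
theorem isRegularOp_expansion_zero {L M : DiffOp C} (hM : M ≠ 0) (hLr : IsRegularOp L)
    (hMr : IsRegularOp M) : IsRegularOp (expansion L M 0) := by
  intro j
  rw [(expansion_zero_natDegree L hM).2, expansion_zero, Polynomial.finsetSum_coeff, Finset.sum_div,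
    map_sum]
  refine isBigOX_sum _ _ fun n _ => ?_
  rw [Polynomial.coeff_smul, smul_eq_mul, mul_div_right_comm, map_mul]
  simpa only [add_zero] using (hMr n).mul (isBigOX_iterate_expansionD hLr n 0 j)

end ExpansionLead

/-! ### Products with an element of a differential module -/

section SquareZero

variable {R : Type u} {N : Type u} [CommRing R] [Differential R] [AddCommGroup N] [Module R N]
  [Module Rᵐᵒᵖ N] [IsCentralScalar R N]

/-- The square-zero extension of a differential ring by a differential module. -/
@[reducible] def squareZeroDifferential (d : N →+ N)
    (hd : ∀ (a : R) (v : N), d (a • v) = a′ • v + a • d v) :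
    Differential (TrivSqZeroExt R N) :=
  mkDifferential
    { toFun := fun x => (x.fst′, d x.snd)
      map_zero' := by
        refine Prod.ext ?_ ?_
        · exact map_zero (Differential.deriv (R := R))
        · exact map_zero d
      map_add' := fun x y => by
        refine Prod.ext ?_ ?_
        · exact map_add (Differential.deriv (R := R)) x.fst y.fst
        · exact map_add d x.snd y.snd }
    (fun x y => by
      refine TrivSqZeroExt.ext ?_ ?_
      · change ((x.fst * y.fst)′) = x.fst * (y.fst′) + y.fst * (x.fst′)
        rw [Derivation.leibniz]; rfl
      · change d (x.fst • y.snd + MulOpposite.op y.fst • x.snd) =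
          (x.fst • d y.snd + MulOpposite.op (y.fst′) • x.snd) +
          (y.fst • d x.snd + MulOpposite.op (x.fst′) • y.snd)
        simp only [op_smul_eq_smul, map_add, hd]
        abel)

variable [Algebra (RatFunc C) R] [DifferentialAlgebra (RatFunc C) R] [Module (RatFunc C) N]
  [IsScalarTower (RatFunc C) R N]

/-- The hypothesis on products speaks of differential rings, while `v` lives in a module. In the
square-zero extension `R ⊕ N` both `f` and `v` are ring elements whose product is `f • v`, so the
expansion identity can be read off in `N`. -/
theorem sum_iterate_smul_opAct_eq_zero (d : N →+ N)
    (hd : ∀ (a : R) (v : N), d (a • v) = a′ • v + a • d v) {L Q M : DiffOp C}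
    (hL : 0 < L.natDegree) (hM : AnnihilatesProducts L Q M) {f : R} (hf : L.act f = 0) {v : N}
    (hv : opAct d v Q = 0) :
    ∑ i ∈ Finset.range L.natDegree,
      (fun g : R => g′)^[i] f • opAct d v (expansion L M i) = 0 := by
  let := squareZeroDifferential d hd
  let F := TrivSqZeroExt R N
  have hinl : ∀ a : R, derivHom F (TrivSqZeroExt.inl a) = TrivSqZeroExt.inl (a′) := fun a => by
    refine TrivSqZeroExt.ext rfl ?_
    exact map_zero d
  have hinr : ∀ w : N, derivHom F (TrivSqZeroExt.inr w) = TrivSqZeroExt.inr (d w) := fun w => by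
    refine TrivSqZeroExt.ext ?_ rfl
    exact map_zero (Differential.deriv (R := R))
  have : DifferentialAlgebra (RatFunc C) F := ⟨fun a => by
    have : algebraMap (RatFunc C) F a = TrivSqZeroExt.inl (algebraMap (RatFunc C) R a) := rfl
    rw [this]
    exact (hinl _).trans (by rw [deriv_algebraMap]; rfl)⟩
  let φ : R →ₗ[RatFunc C] F := (TrivSqZeroExt.inlAlgHom (RatFunc C) R N).toLinearMap
  let ψ : N →ₗ[RatFunc C] F := (TrivSqZeroExt.inrHom R N).restrictScalars (RatFunc C)
  have hφ : ∀ P : DiffOp C, P.act (TrivSqZeroExt.inl f : F) = TrivSqZeroExt.inl (P.act f) := by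
    intro P
    rw [act_eq_opAct, act_eq_opAct]
    exact (map_opAct φ (d := derivHom R) (d' := derivHom F) (fun a => (hinl a).symm) f P).symm
  have hψ : ∀ P : DiffOp C, P.act (TrivSqZeroExt.inr v : F) = TrivSqZeroExt.inr (opAct d v P) := by
    intro P
    rw [act_eq_opAct]
    exact (map_opAct ψ (d := d) (d' := derivHom F) (fun a => (hinr a).symm) v P).symm
  have hit : ∀ i, (fun g : F => g′)^[i] (TrivSqZeroExt.inl f) =
      TrivSqZeroExt.inl ((fun g : R => g′)^[i] f) := by
    intro i
    induction i with
    | zero => rfl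
    | succ i ih => rw [Function.iterate_succ_apply', ih, Function.iterate_succ_apply']; exact hinl _
  have hLf : L.act (TrivSqZeroExt.inl f : F) = 0 := by rw [hφ, hf, TrivSqZeroExt.inl_zero]
  have h := hM F (TrivSqZeroExt.inl f) (TrivSqZeroExt.inr v) hLf
    (by rw [hψ, hv, TrivSqZeroExt.inr_zero])
  rw [act_mul_eq_expansion L hL hLf] at h
  apply TrivSqZeroExt.inr_injective (R := R)
  rw [TrivSqZeroExt.inr_zero, ← h, TrivSqZeroExt.inr_sum]
  refine Finset.sum_congr rfl fun i _ => ?_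
  rw [hit, hψ, TrivSqZeroExt.inl_mul_inr]

end SquareZero

/-! ### The companion module -/

section Companion

variable [CharZero C]

/-- The derivation on `C((x))[D] / C((x))[D] Q` in terms of remainders. -/
def companionD (Q : DiffOp C) : (LaurentSeries C)[X] →+ (LaurentSeries C)[X] where
  toFun v := Polynomial.X * v + Differential.mapCoeffs v - Polynomial.C (v.coeff (Q.natDegree - 1)) *
    (Q.leadingCoeff⁻¹ • Q).map (algebraMap (RatFunc C) (LaurentSeries C))
  map_zero' := by simp
  map_add' v w := by simp only [map_add, mul_add, Polynomial.coeff_add, add_mul]; abel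

omit [CharZero C] in
theorem companionD_apply (Q : DiffOp C) (v : (LaurentSeries C)[X]) :
    companionD Q v = Polynomial.X * v + Differential.mapCoeffs v -
      Polynomial.C (v.coeff (Q.natDegree - 1)) *
        (Q.leadingCoeff⁻¹ • Q).map (algebraMap (RatFunc C) (LaurentSeries C)) := rfl

omit [CharZero C] in
theorem companionD_smul (Q : DiffOp C) (a : LaurentSeries C) (v : (LaurentSeries C)[X]) :
    companionD Q (a • v) = a′ • v + a • companionD Q v := by
  simp only [companionD_apply, Polynomial.smul_eq_C_mul, Derivation.leibniz, smul_eq_mul,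
    Differential.mapCoeffs_C, Polynomial.coeff_C_mul, Polynomial.C_mul]
  ring

theorem mapCoeffs_X_pow {R : Type*} [CommRing R] [Differential R] (i : ℕ) :
    Differential.mapCoeffs (Polynomial.X ^ i : R[X]) = 0 := by
  rw [← Polynomial.monomial_one_right_eq_X_pow, Differential.mapCoeffs_monomial,
    Derivation.map_one_eq_zero, map_zero]

omit [CharZero C] in
theorem companionD_iterate (Q : DiffOp C) {i : ℕ} (hi : i < Q.natDegree) :
    (companionD Q)^[i] 1 = Polynomial.X ^ i := by
  induction i with
  | zero => simp
  | succ i ih =>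
    rw [Function.iterate_succ_apply', ih (by omega), companionD_apply, Polynomial.coeff_X_pow,
      if_neg (by omega), mapCoeffs_X_pow, pow_succ']
    simp

omit [CharZero C] in
theorem opAct_companionD_of_lt (Q : DiffOp C) {P : DiffOp C} (hP : P.natDegree < Q.natDegree) :
    opAct (companionD Q) 1 P = P.map (algebraMap (RatFunc C) (LaurentSeries C)) := by
  rw [opAct_eq_sum_range _ _ _ hP]
  conv_rhs => rw [P.as_sum_range' _ hP, Polynomial.map_sum]
  refine Finset.sum_congr rfl fun i hi => ?_
  rw [companionD_iterate Q (Finset.mem_range.1 hi), Polynomial.map_monomial,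
    ← Polynomial.C_mul_X_pow_eq_monomial, ← Polynomial.smul_eq_C_mul, algebraMap_smul]

-- The element 1 is a generic solution of `Q`: its first derivatives are the independent monomials
-- `Xⁱ`, and the derivative of order `ord Q` is defined exactly so that `Q` kills it.
omit [CharZero C] in
theorem opAct_companionD_self (Q : DiffOp C) (hQ : 0 < Q.natDegree) :
    opAct (companionD Q) 1 Q = 0 := by
  have hl : Q.leadingCoeff ≠ 0 := by
    rw [Ne, Polynomial.leadingCoeff_eq_zero]; rintro rfl; simp at hQ
  have h1 : (companionD Q)^[Q.natDegree] 1 = Polynomial.X ^ Q.natDegree -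
      (Q.leadingCoeff⁻¹ • Q).map (algebraMap (RatFunc C) (LaurentSeries C)) := by
    obtain ⟨q, hq⟩ : ∃ q, Q.natDegree = q + 1 := ⟨Q.natDegree - 1, by omega⟩
    rw [hq, Function.iterate_succ_apply', companionD_iterate Q (by omega), companionD_apply, hq,
      Nat.add_sub_cancel, Polynomial.coeff_X_pow_self, mapCoeffs_X_pow, pow_succ']
    simp
  have h2 : Q.map (algebraMap (RatFunc C) (LaurentSeries C)) =
      (∑ i ∈ Finset.range Q.natDegree, Q.coeff i • (companionD Q)^[i] 1) +
        Q.leadingCoeff • Polynomial.X ^ Q.natDegree := by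
    conv_lhs => rw [Q.as_sum_range' _ (Nat.lt_succ_self _), Polynomial.map_sum,
      Finset.sum_range_succ]
    congr 1
    · refine Finset.sum_congr rfl fun i hi => ?_
      rw [companionD_iterate Q (Finset.mem_range.1 hi), Polynomial.map_monomial,
        ← Polynomial.C_mul_X_pow_eq_monomial, ← Polynomial.smul_eq_C_mul, algebraMap_smul]
    · rw [Polynomial.map_monomial,
        ← Polynomial.C_mul_X_pow_eq_monomial, ← Polynomial.smul_eq_C_mul, algebraMap_smul]
      rfl
  rw [opAct_eq_sum_range _ _ _ (Nat.lt_succ_self _), Finset.sum_range_succ, h1, smul_sub,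
    ← add_sub_assoc, Polynomial.coeff_natDegree, ← h2, sub_eq_zero,
    ← algebraMap_smul (LaurentSeries C) Q.leadingCoeff, Polynomial.smul_eq_C_mul,
    Polynomial.smul_eq_C_mul, Polynomial.map_mul, Polynomial.map_C, ← mul_assoc,
    ← Polynomial.C_mul, ← map_mul, mul_inv_cancel₀ hl, map_one, Polynomial.C_1, one_mul]

/-- If `M` annihilates the products of the solutions of `L` and `Q`, then `Q` is a right factor of
all the operators of the expansion of `M`. -/
theorem AnnihilatesProducts.expansion_mem {L Q M : DiffOp C} (hL : 0 < L.natDegree)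
    (hLr : IsRegularOp L) (hQ : Q ≠ 0) (h : AnnihilatesProducts L Q M) {i : ℕ}
    (hi : i < L.natDegree) : expansion L M i ∈ principal Q := by
  have hL0 : L ≠ 0 := by rintro rfl; simp at hL
  obtain ⟨R, S, hRS, hS⟩ := exists_mul_add Q hQ (expansion L M i)
  suffices S = 0 by
    rw [hRS, this, add_zero, mem_principal]
    exact ⟨R, rfl⟩
  by_contra hS0
  have hlt := Polynomial.natDegree_lt_natDegree hS0 hS
  obtain ⟨f, hf, hLf, -⟩ := exists_solution_basis hL0 hLr
  have hQ1 := opAct_companionD_self Q (by omega)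
  -- The product relations for a full system of solutions of `L` hold coefficientwise in the
  -- companion module, so the invertible Wronskian matrix isolates each `Aᵢ · 1`.
  have hz : opAct (companionD Q) 1 (expansion L M i) = 0 := by
    refine Polynomial.ext fun n => ?_
    rw [Polynomial.coeff_zero]
    refine eq_zero_of_wronskian L hL0 hf hLf
      (A := fun i => (opAct (companionD Q) 1 (expansion L M i)).coeff n) (fun j => ?_) hi
    have := sum_iterate_smul_opAct_eq_zero (companionD Q) (companionD_smul Q) hL h (hLf j) hQ1
    simpa [Polynomial.finsetSum_coeff] using congrArg (fun p => Polynomial.coeff p n) this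
  have hconn : IsConnection C (companionD Q) := by
    intro a v
    rw [← algebraMap_smul (LaurentSeries C) a v, companionD_smul, deriv_algebraMap,
      algebraMap_smul, algebraMap_smul]
  -- `Q` kills the generic solution, so only the remainder survives; having order below `ord Q`, it
  -- acts on 1 as its own coefficient vector.
  rw [hRS, map_add, opAct_mul hconn, hQ1, opAct_companionD_of_lt Q hlt] at hz
  have h0 : opAct (companionD Q) 0 R = 0 := by
    simp [opAct_apply, iterate_map_zero, Polynomial.sum]
  rw [h0, zero_add, Polynomial.map_eq_zero_iff (algebraMap (RatFunc C) (LaurentSeries C)).injective] at hz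
  exact hS0 hz

end Companion

/-! ### The greatest common right divisor of the expansion -/

section Gcrd

/-- The left ideal generated by a set of operators. -/
def leftSpan (s : Set (DiffOp C)) : Submodule (RatFunc C) (DiffOp C) :=
  Submodule.span (RatFunc C) {P | ∃ n, ∃ Q ∈ s, P = leftDHom^[n] Q}

theorem isLeftIdeal_leftSpan (s : Set (DiffOp C)) : IsLeftIdeal (leftSpan s) := by
  intro P hP
  rw [← leftDHom_apply]
  induction hP using Submodule.span_induction with
  | mem P h =>
    obtain ⟨n, Q, hQ, rfl⟩ := h
    exact Submodule.subset_span ⟨n + 1, Q, hQ, (Function.iterate_succ_apply' _ _ _).symm⟩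
  | zero => rw [map_zero]; exact Submodule.zero_mem _
  | add P Q _ _ hP hQ => rw [map_add]; exact Submodule.add_mem _ hP hQ
  | smul a P hP ih =>
    rw [leftD_isConnection]
    exact Submodule.add_mem _ (Submodule.smul_mem _ _ hP) (Submodule.smul_mem _ _ ih)

theorem subset_leftSpan (s : Set (DiffOp C)) : s ⊆ leftSpan s :=
  fun Q hQ => Submodule.subset_span ⟨0, Q, hQ, rfl⟩

theorem IsLeftIdeal.leftSpan_le {I : Submodule (RatFunc C) (DiffOp C)} (hI : IsLeftIdeal I)
    {s : Set (DiffOp C)} (hs : s ⊆ I) : leftSpan s ≤ I := by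
  refine Submodule.span_le.2 ?_
  rintro _ ⟨n, Q, hQ, rfl⟩
  induction n with
  | zero => exact hs hQ
  | succ n ih => rw [Function.iterate_succ_apply']; exact hI _ ih

/-- Used to pass a common solution of several operators to their greatest common right divisor. -/
theorem isLeftIdeal_ker_act (h : LaurentSeries C) :
    IsLeftIdeal (LinearMap.ker (opAct (C := C) (derivHom (LaurentSeries C)) h)) := by
  intro P hP
  rw [LinearMap.mem_ker] at hP ⊢
  rw [opAct_leftD derivHom_isConnection, hP, map_zero]

/-- `G` generates the left ideal spanned by `s`. Membership in every left ideal containing `s`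
serves as the Bézout property. -/
theorem exists_gcrd {s : Set (DiffOp C)} {A : DiffOp C} (hA : A ∈ s) (hA0 : A ≠ 0) :
    ∃ G : DiffOp C, IsPrimitiveOp G ∧ (∀ P ∈ s, P ∈ principal G) ∧
      (∀ I, IsLeftIdeal I → s ⊆ I → G ∈ I) := by
  have hne : leftSpan s ≠ ⊥ :=
    (Submodule.ne_bot_iff _).2 ⟨A, subset_leftSpan s hA, hA0⟩
  obtain ⟨G, hG, hG0, hmin⟩ := exists_minimal_natDegree hne
  obtain ⟨a, ha, hprim⟩ := exists_isPrimitiveOp_smul G hG0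
  refine ⟨a • G, hprim, fun P hP => ?_, fun I hI hs =>
    I.smul_mem a (hI.leftSpan_le hs hG)⟩
  rw [principal_smul G ha]
  exact (isLeftIdeal_leftSpan s).le_principal hG hG0 hmin (subset_leftSpan s hP)

/-- The action of an operator on Laurent series is linear over the constants. -/
def actLM (P : DiffOp C) : LaurentSeries C →ₗ[C] LaurentSeries C where
  toFun f := P.act f
  map_add' := act_add_right P
  map_smul' c f := by
    have h : ∀ i : ℕ, (fun g : LaurentSeries C => g′)^[i] (c • f) =
        c • (fun g : LaurentSeries C => g′)^[i] f := by
      intro i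
      induction i with
      | zero => rfl
      | succ i ih => simp only [Function.iterate_succ', Function.comp_apply, ih, laurent_deriv_smul]
    simp only [DiffOp.act, Polynomial.sum, h, laurent_mul_smul, ← Finset.smul_sum, RingHom.id_apply]

theorem actLM_apply (P : DiffOp C) (f : LaurentSeries C) : actLM P f = P.act f := rfl

theorem solutionSpace_mono {P Q : DiffOp C} (h : P ∈ principal Q) :
    solutionSpace Q ≤ solutionSpace P := by
  obtain ⟨R, rfl⟩ := h
  intro f hf
  rw [mem_solutionSpace] at hf ⊢
  rw [← mul_eq_opAct, act_mul, hf, act_zero]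

theorem natDegree_le_of_mem_principal {P Q : DiffOp C} (hP : P ≠ 0) (hQ : Q ≠ 0)
    (h : P ∈ principal Q) : Q.natDegree ≤ P.natDegree := by
  obtain ⟨R, rfl⟩ := h
  have hR : R ≠ 0 := by rintro rfl; exact hP (map_zero _)
  rw [← mul_eq_opAct, (degree_mul_op R Q hR hQ).1]
  exact Nat.le_add_left _ _

/-- A right factor of full order is a scalar multiple. -/
theorem exists_smul_of_mem_principal {P Q : DiffOp C} (hP : P ≠ 0) (hQ : Q ≠ 0)
    (h : P ∈ principal Q) (hd : P.natDegree ≤ Q.natDegree) :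
    ∃ a : RatFunc C, a ≠ 0 ∧ P = a • Q := by
  obtain ⟨R, rfl⟩ := h
  have hR : R ≠ 0 := by rintro rfl; exact hP (map_zero _)
  rw [← mul_eq_opAct, (degree_mul_op R Q hR hQ).1] at hd
  obtain ⟨a, rfl⟩ := Polynomial.natDegree_eq_zero.1 (show R.natDegree = 0 by omega)
  refine ⟨a, fun h => hR (by rw [h, Polynomial.C_0]), ?_⟩
  exact opAct_monomial leftDHom Q 0 a

theorem solutionSpace_eq_ker (P : DiffOp C) : solutionSpace P = LinearMap.ker (actLM P) := by
  ext f
  rw [mem_solutionSpace, LinearMap.mem_ker, actLM_apply]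

theorem finrank_ker_comp_le {V : Type*} [AddCommGroup V] [Module C V] (r g : V →ₗ[C] V)
    [Module.Finite C (LinearMap.ker (r ∘ₗ g))] [Module.Finite C (LinearMap.ker g)]
    [Module.Finite C (LinearMap.ker r)] :
    Module.finrank C (LinearMap.ker (r ∘ₗ g)) ≤
      Module.finrank C (LinearMap.ker r) + Module.finrank C (LinearMap.ker g) := by
  let T : LinearMap.ker (r ∘ₗ g) →ₗ[C] LinearMap.ker r := g.restrict fun f hf => hf
  have h1 := T.finrank_range_add_finrank_ker
  have h2 := Submodule.finrank_le (LinearMap.range T)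
  have h3 : Module.finrank C (LinearMap.ker T) ≤ Module.finrank C (LinearMap.ker g) := by
    let j : LinearMap.ker T →ₗ[C] LinearMap.ker g :=
      ((LinearMap.ker (r ∘ₗ g)).subtype ∘ₗ (LinearMap.ker T).subtype).codRestrict _ fun x =>
        congrArg Subtype.val (LinearMap.mem_ker.1 x.2)
    refine LinearMap.finrank_le_finrank_of_injective (f := j) fun x y hxy => ?_
    exact Subtype.ext (Subtype.ext (congrArg (fun z => z.1) hxy))
  omega

variable [CharZero C]

/-- A right factor of an operator with a full system of solutions has a full system of
solutions. -/
theorem finrank_solutionSpace_of_mem_principal {A G : DiffOp C} (hA : A ≠ 0) (hG : G ≠ 0)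
    (hfull : Module.finrank C (solutionSpace A) = A.natDegree) (h : A ∈ principal G) :
    Module.finrank C (solutionSpace G) = G.natDegree := by
  refine (finrank_solutionSpace_le G hG).antisymm ?_
  obtain ⟨R, rfl⟩ := h
  have hR : R ≠ 0 := by rintro rfl; exact hA (map_zero _)
  rw [← mul_eq_opAct] at hfull hA
  rw [(degree_mul_op R G hR hG).1] at hfull
  have hcomp : actLM (DiffOp.mul R G) = actLM R ∘ₗ actLM G :=
    LinearMap.ext fun f => act_mul R G f
  have f1 := finite_solutionSpace _ hA
  have f2 := finite_solutionSpace _ hG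
  have f3 := finite_solutionSpace _ hR
  have hle := finrank_solutionSpace_le R hR
  rw [solutionSpace_eq_ker, hcomp] at hfull f1
  rw [solutionSpace_eq_ker] at f2 f3 hle ⊢
  -- `ord R + ord G = dim ker(RG) ≤ dim ker R + dim ker G ≤ ord R + dim ker G` forces `ord G ≤ dim
  -- ker G`.
  have := finrank_ker_comp_le (actLM R) (actLM G)
  omega

/-- For fixed `h`, the equations `M · (h fⱼ) = 0` over a basis of solutions of `L` form a linear
system in the unknowns `Aᵢ · h` whose matrix is the Wronskian. -/
theorem mem_solColon_iff {L : DiffOp C} (hL : 0 < L.natDegree) (hLr : IsRegularOp L)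
    (M : DiffOp C) {h : LaurentSeries C} :
    h ∈ solColon M L ↔ ∀ i < L.natDegree, (expansion L M i).act h = 0 := by
  have hL0 : L ≠ 0 := by rintro rfl; simp at hL
  constructor
  · intro hh i hi
    obtain ⟨f, hf, hLf, -⟩ := exists_solution_basis hL0 hLr
    refine eq_zero_of_wronskian L hL0 hf hLf (A := fun i => (expansion L M i).act h) (fun j => ?_) hi
    rw [← act_mul_eq_expansion L hL (hLf j), mul_comm]
    exact hh (f j) (hLf j)
  · intro hh f hf
    rw [mem_solutionSpace, mul_comm, act_mul_eq_expansion L hL hf]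
    exact Finset.sum_eq_zero fun i hi => by rw [hh i (Finset.mem_range.1 hi), mul_zero]

/-- The colon space is the full solution space of an operator that governs all quotients. -/
theorem exists_quotient {M L : DiffOp C} (hM : M ≠ 0) (hL : 0 < L.natDegree)
    (hMr : IsRegularOp M) (hLr : IsRegularOp L) :
    ∃ G : DiffOp C, IsPrimitiveOp G ∧ solutionSpace G = solColon M L ∧
      Module.rank C (solColon M L) = G.natDegree ∧
      ∀ Q : DiffOp C, Q ≠ 0 → (IsRightFactor (symProd L Q) M ↔ G ∈ principal Q) := by
  have hA0 := expansion_zero_ne_zero L hM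
  obtain ⟨G, hG, hGs, hGI⟩ := exists_gcrd (s := {P | ∃ i < L.natDegree, P = expansion L M i})
    ⟨0, hL, rfl⟩ hA0
  have hV : solutionSpace G = solColon M L := by
    ext h
    rw [mem_solColon_iff hL hLr]
    constructor
    · intro hh i hi
      exact solutionSpace_mono (hGs _ ⟨i, hi, rfl⟩) hh
    · intro hh
      -- The annihilator of `h` is a left ideal containing every `Aᵢ`, hence also `G`.
      have := hGI _ (isLeftIdeal_ker_act h) (by
        rintro _ ⟨i, hi, rfl⟩
        rw [SetLike.mem_coe, LinearMap.mem_ker, ← act_eq_opAct]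
        exact hh i hi)
      rw [LinearMap.mem_ker, ← act_eq_opAct] at this
      exact this
  have hfull : Module.finrank C (solutionSpace G) = G.natDegree :=
    finrank_solutionSpace_of_mem_principal hA0 hG.ne_zero
      (finrank_solutionSpace hA0 (isRegularOp_expansion_zero hM hLr hMr)) (hGs _ ⟨0, hL, rfl⟩)
  refine ⟨G, hG, hV, ?_, fun Q hQ => ?_⟩
  · have := finite_solutionSpace G hG.ne_zero
    rw [← hV, ← hfull, Module.finrank_eq_rank]
  · rw [isRightFactor_symProd_iff hL hQ]
    constructor
    · intro h
      refine hGI _ (isLeftIdeal_principal Q) ?_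
      rintro _ ⟨i, hi, rfl⟩
      exact h.expansion_mem hL hLr hQ hi
    · intro h
      exact annihilatesProducts_of_expansion_mem hL fun i hi =>
        (isLeftIdeal_principal Q).principal_le h (hGs _ ⟨i, hi, rfl⟩)

end Gcrd

/-! ### Orders of the elements of the colon space -/

section ColonOrder

variable [CharZero C]

theorem exists_solution_seq {L : DiffOp C} (hL : L ≠ 0) (hreg : IsRegularOp L) :
    ∃ f : ℕ → LaurentSeries C, ∀ j < L.natDegree, L.act (f j) = 0 ∧
      IsBigOX (f j) j ∧ (f j).coeff j = 1 := by
  obtain ⟨f, -, hLf, h⟩ := exists_solution_basis hL hreg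
  refine ⟨fun j => if hj : j < L.natDegree then f ⟨j, hj⟩ else 0, fun j hj => ?_⟩
  simp only [hj, dif_pos]
  exact ⟨hLf _, (h ⟨j, hj⟩).2⟩

/-- With solutions `f₀, …, f_{r-1}` of `L` of orders `0, …, r-1`, the product `h f_{r-1}` solves `M`
and `f₀⋯f_{r-2}` solves `L^{⊗(r-1)}`. Their product is a solution of `N` of order `ord h + (0 + 1 +
⋯ + (r-1))`. -/
theorem order_mem_indicialRoots {M L : DiffOp C} (hM : 0 < M.natDegree) (hL : 0 < L.natDegree)
    (hMr : IsRegularOp M) (hLr : IsRegularOp L) {h : LaurentSeries C} (hh : h ∈ solColon M L)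
    (h0 : h ≠ 0) : 0 ≤ h.order ∧
      ∃ z ∈ indicialRoots (symProd M (symPow L (L.natDegree - 1))),
        (z : ℤ) = h.order + (L.natDegree * (L.natDegree - 1) / 2 : ℕ) := by
  have hL0 : L ≠ 0 := by rintro rfl; simp at hL
  have hM0 : M ≠ 0 := by rintro rfl; simp at hM
  obtain ⟨f, hf⟩ := exists_solution_seq hL0 hLr
  have hho := HahnSeries.coeff_order_eq_zero.not.2 h0
  have hpos : 0 ≤ h.order := by
    by_contra hlt
    obtain ⟨h1, h2, h3⟩ := hf 0 hL
    have h4 := (isBigOX_order h).coeff_mul h2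
    -- `f₀` has nonzero constant term, so a pole of `h` would survive in a solution of `M`, which is
    -- a power series.
    have h5 : IsBigOX (h * f 0) 0 := solutionSpace_le_bigOX hM0 hMr (hh (f 0) h1)
    rw [h3, mul_one, h5 _ (by push_cast; omega)] at h4
    exact hho h4.symm
  refine ⟨hpos, ?_⟩
  have hprod : ∀ s ≤ L.natDegree, (symPow L s).act (∏ j ∈ Finset.range s, f j) = 0 ∧
      IsBigOX (∏ j ∈ Finset.range s, f j) (∑ j ∈ Finset.range s, j : ℕ) ∧
      (∏ j ∈ Finset.range s, f j).coeff (∑ j ∈ Finset.range s, j : ℕ) = 1 := by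
    intro s hs
    induction s with
    | zero =>
      simp only [Finset.range_zero, Finset.prod_empty, Finset.sum_empty, symPow, Nat.cast_zero]
      refine ⟨?_, fun n hn => ?_, ?_⟩
      · rw [act_X, deriv_laurent]
        ext n
        rw [laurentDeriv_coeff, HahnSeries.coeff_one]
        split_ifs with h <;> simp [h]
      · rw [HahnSeries.coeff_one, if_neg hn.ne]
      · rw [HahnSeries.coeff_one, if_pos rfl]
    | succ s ih =>
      obtain ⟨i1, i2, i3⟩ := ih (by omega)
      obtain ⟨j1, j2, j3⟩ := hf s (by omega)
      rw [Finset.prod_range_succ, Finset.sum_range_succ, Nat.cast_add]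
      refine ⟨?_, i2.mul j2, ?_⟩
      · rw [mul_comm]
        exact (isSymProd_symProd hL (symPow_ne_zero hL s)).2.1 _ _ _ j1 i1
      · rw [i2.coeff_mul j2, i3, j3, one_mul]
  -- From here `r` is `ord L - 1`: the last solution `f r` is reserved for the factor `h * f r` that
  -- solves `M`.
  obtain ⟨r, hr⟩ : ∃ r, L.natDegree = r + 1 := ⟨L.natDegree - 1, by omega⟩
  obtain ⟨i1, i2, i3⟩ := hprod r (by omega)
  obtain ⟨j1, j2, j3⟩ := hf r (by omega)
  have hN := isSymProd_symProd hM (symPow_ne_zero hL r)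
  have hg1 : M.act (h * f r) = 0 := hh (f r) j1
  have hO := ((isBigOX_order h).mul j2).mul i2
  have hc := ((isBigOX_order h).mul j2).coeff_mul i2
  rw [(isBigOX_order h).coeff_mul j2, i3, j3, mul_one, mul_one] at hc
  obtain ⟨z, hz⟩ := Int.eq_ofNat_of_zero_le
    (show 0 ≤ h.order + r + (∑ j ∈ Finset.range r, j : ℕ) by positivity)
  rw [hz] at hO hc
  refine ⟨z, ?_, ?_⟩
  · rw [hr, Nat.add_sub_cancel]
    exact mem_indicialRoots hN.1.ne_zero (hN.2.1 _ _ _ hg1 i1) hO (hc ▸ hho)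
  · have h1 := Finset.sum_range_id (r + 1)
    rw [Finset.sum_range_succ] at h1
    rw [← hz, hr, ← h1]
    push_cast
    ring

end ColonOrder

/-! ### Truncations -/

section Truncation

theorem isBigOX_sub_truncate (k : ℤ) (f : LaurentSeries C) : IsBigOX (f - truncate k f) (k + 1) := by
  intro n hn
  rw [HahnSeries.coeff_sub, truncate, HahnSeries.coe_truncLTLinearMap,
    HahnSeries.coeff_truncLT_of_lt hn, sub_self]

/-- A finite-dimensional space contains no nonzero elements of high order. -/
theorem exists_isBigOX_imp_eq_zero (V : Submodule C (LaurentSeries C)) [Module.Finite C V] :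
    ∃ K : ℤ, ∀ f ∈ V, IsBigOX f K → f = 0 := by
  -- The subspaces of elements of order at least `n` decrease and must stabilise; an element of the
  -- stable subspace has arbitrarily high order.
  let s : ℕ →o (Submodule C V)ᵒᵈ :=
    { toFun := fun n => OrderDual.toDual ((bigOX C (n : ℤ)).comap V.subtype)
      monotone' := fun m n hmn => by
        intro x hx
        exact IsBigOX.mono hx (by exact_mod_cast hmn) }
  obtain ⟨n, hn⟩ := IsArtinian.monotone_stabilizes s
  refine ⟨n, fun f hf hfn => ?_⟩
  by_contra h0
  have hmem : ∀ m, n ≤ m → IsBigOX f (m : ℤ) := fun m hm => by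
    have h1 : (⟨f, hf⟩ : V) ∈ OrderDual.ofDual (s n) := hfn
    rw [hn m hm] at h1
    exact h1
  have h1 := (hmem (n + (f.order.toNat + 1)) (by omega)).le_order h0
  push_cast at h1
  omega

theorem isBigOX_coeff_of_polynomial {a : RatFunc C} {p : C[X]}
    (h : a = algebraMap C[X] (RatFunc C) p) :
    IsBigOX (algebraMap (RatFunc C) (LaurentSeries C) a) 0 := by
  rw [h, ← IsScalarTower.algebraMap_apply]
  exact isBigOX_algebraMap_polynomial p

theorem IsPrimitiveOp.isBigOX_act {Q : DiffOp C} (hQ : IsPrimitiveOp Q) {δ : ℕ}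
    (hδ : Q.natDegree ≤ δ) {f : LaurentSeries C} {m : ℤ} (hf : IsBigOX f m) :
    IsBigOX (Q.act f) (m - δ) := by
  obtain ⟨q, hq, -⟩ := hQ
  exact SymDiv.isBigOX_act hδ
    (fun i => isBigOX_coeff_of_polynomial (by rw [hq, Polynomial.coeff_map])) hf

theorem algebraMap_polynomial_eq_sum (p : C[X]) {d : ℕ} (hp : p.natDegree ≤ d) :
    algebraMap C[X] (LaurentSeries C) p =
      ∑ a ∈ Finset.range (d + 1), p.coeff a • algebraMap C[X] (LaurentSeries C) (Polynomial.X ^ a) := by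
  have hC : ∀ c : C, algebraMap C[X] (LaurentSeries C) (Polynomial.C c) = HahnSeries.C c := by
    intro c
    rw [HahnSeries.algebraMap_apply', PowerSeries.algebraMap_apply']
    simp [HahnSeries.ofPowerSeries_C]
  conv_lhs => rw [p.as_sum_range_C_mul_X_pow' (Nat.lt_succ_of_le hp), map_sum]
  refine Finset.sum_congr rfl fun a _ => ?_
  rw [map_mul, hC, HahnSeries.C_mul_eq_smul]

/-- Operators with bounded order and degrees that map the elements of a finite-dimensional space to
series of sufficiently high order annihilate the space. -/
theorem exists_forall_act_eq_zero (W : Submodule C (LaurentSeries C)) [Module.Finite C W]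
    (δ d : ℕ) : ∃ K : ℤ, ∀ Q : DiffOp C, Q.natDegree ≤ δ → CoeffDegreesLE Q d →
      (∀ w ∈ W, IsBigOX (Q.act w) K) → ∀ w ∈ W, Q.act w = 0 := by
  let b := Module.finBasis C W
  -- Every `Q · bⱼ` with the given bounds lies in the span of the series `x^a bⱼ⁽ⁱ⁾`. This span does
  -- not depend on `Q`, so one precision serves all `Q`.
  let v : Fin (d + 1) × Fin (δ + 1) × Fin (Module.finrank C W) → LaurentSeries C := fun x =>
    algebraMap C[X] (LaurentSeries C) (Polynomial.X ^ (x.1 : ℕ)) *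
      (fun g : LaurentSeries C => g′)^[x.2.1] (b x.2.2 : LaurentSeries C)
  have := FiniteDimensional.span_of_finite C (Set.finite_range v)
  obtain ⟨K, hK⟩ := exists_isBigOX_imp_eq_zero (Submodule.span C (Set.range v))
  refine ⟨K, fun Q hδ hd hQ w hw => ?_⟩
  have hb : ∀ j, Q.act (b j : LaurentSeries C) = 0 := by
    intro j
    refine hK _ ?_ (hQ _ (b j).2)
    rw [act_eq_sum_range Q (Nat.lt_succ_of_le hδ)]
    refine Submodule.sum_mem _ fun i hi => ?_
    obtain ⟨p, hp, hpd⟩ := hd i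
    rw [hp, ← IsScalarTower.algebraMap_apply, algebraMap_polynomial_eq_sum p (by exact_mod_cast hpd),
      Finset.sum_mul]
    refine Submodule.sum_mem _ fun a ha => ?_
    rw [smul_mul_assoc]
    exact Submodule.smul_mem _ _ (Submodule.subset_span
      ⟨(⟨a, Finset.mem_range.1 ha⟩, ⟨i, Finset.mem_range.1 hi⟩, j), rfl⟩)
  have h1 : (actLM Q).comp W.subtype = 0 := b.ext hb
  exact congrArg (fun φ : W →ₗ[C] LaurentSeries C => φ ⟨w, hw⟩) h1

/-- Primitive operators that differ by a rational factor have coefficients of the same degrees. -/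
theorem CoeffDegreesLE.of_smul {G Q : DiffOp C} {d : ℤ} (hG : IsPrimitiveOp G)
    (hQ : IsPrimitiveOp Q) {a : RatFunc C} (ha : a ≠ 0) (h : G = a • Q) (hd : CoeffDegreesLE G d) :
    CoeffDegreesLE Q d := by
  obtain ⟨g, rfl, hg, -⟩ := hG
  obtain ⟨q, rfl, hq, -⟩ := hQ
  have hinj := RatFunc.algebraMap_injective C
  have hu : IsUnit (Polynomial.C a) := Polynomial.isUnit_C.2 (isUnit_iff_ne_zero.2 ha)
  rw [Polynomial.smul_eq_C_mul] at h
  let := Classical.choice (inferInstance : Nonempty (NormalizedGCDMonoid C[X]))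
  -- By Gauss's lemma, primitive polynomials proportional over `C(x)` are associated over `C[x]`, so
  -- they differ by a nonzero constant.
  have h1 : g ∣ q := (Polynomial.IsPrimitive.dvd_iff_fraction_map_dvd_fraction_map (RatFunc C) hg).2
    (by rw [h, hu.mul_left_dvd])
  have h2 : q ∣ g := (Polynomial.IsPrimitive.dvd_iff_fraction_map_dvd_fraction_map (RatFunc C) hq).2
    (by rw [h]; exact dvd_mul_left _ _)
  obtain ⟨v, hv⟩ := associated_of_dvd_dvd h2 h1
  obtain ⟨c, hc, hcv⟩ := Polynomial.isUnit_iff.1 v.isUnit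
  obtain ⟨e, he, rfl⟩ := Polynomial.isUnit_iff.1 hc
  intro i
  refine ⟨q.coeff i, Polynomial.coeff_map _ _, ?_⟩
  obtain ⟨p, hp, hpd⟩ := hd i
  rw [Polynomial.coeff_map] at hp
  rw [← hinj hp, ← hv, ← hcv, Polynomial.coeff_mul_C,
    Polynomial.natDegree_mul_C he.ne_zero] at hpd
  exact hpd

theorem IsPrimitiveOp.exists_coeffDegreesLE {G : DiffOp C} (hG : IsPrimitiveOp G) :
    ∃ d : ℕ, CoeffDegreesLE G d := by
  obtain ⟨g, rfl, -⟩ := hG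
  refine ⟨(Finset.range (g.natDegree + 1)).sup fun i => (g.coeff i).natDegree, fun i =>
    ⟨g.coeff i, Polynomial.coeff_map _ _, ?_⟩⟩
  rw [Nat.cast_le]
  rcases Nat.lt_or_ge g.natDegree i with h | h
  · rw [Polynomial.coeff_eq_zero_of_natDegree_lt h]; simp
  · exact Finset.le_sup (f := fun i => (g.coeff i).natDegree) (Finset.mem_range.2 (by omega))

end Truncation

/-! ### Correctness and termination of the algorithm -/

section Algorithm

variable {M L G : DiffOp C}

/-- `G` is a primitive operator whose solution space is the colon space, of full dimension, and
whose right factors are exactly the operators `Q` such that `L ⊗ Q` is a right factor of `M`. -/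
structure GovernsQuotients (M L G : DiffOp C) : Prop where
  isPrimitiveOp : IsPrimitiveOp G
  solutionSpace_eq : solutionSpace G = solColon M L
  rank_eq : Module.rank C (solColon M L) = G.natDegree
  isRightFactor_iff : ∀ Q : DiffOp C, Q ≠ 0 → (IsRightFactor (symProd L Q) M ↔ G ∈ principal Q)

theorem GovernsQuotients.eq_natDegree (hG : GovernsQuotients M L G) {δ : ℕ}
    (h : ColonSpaceDimension M L δ) : δ = G.natDegree := by
  rw [ColonSpaceDimension, hG.rank_eq] at h
  exact_mod_cast h.symm

theorem GovernsQuotients.isGlobalQuasiSymQuotient (hG : GovernsQuotients M L G) :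
    IsGlobalQuasiSymQuotient M L G := by
  refine ⟨hG.isPrimitiveOp, (hG.isRightFactor_iff G hG.isPrimitiveOp.ne_zero).2
    (self_mem_principal G), fun P hP h => ?_⟩
  exact natDegree_le_of_mem_principal hG.isPrimitiveOp.ne_zero hP ((hG.isRightFactor_iff P hP).1 h)

/-- Any global quotient of order `δ` is a rational multiple of `G`, so the coefficient degrees of
`G` bound those of all of them. -/
theorem GovernsQuotients.exists_boundDegree (hG : GovernsQuotients M L G) {δ : ℕ}
    (h : ColonSpaceDimension M L δ) : ∃ d₀ : ℕ, BoundDegree M L δ d₀ := by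
  obtain ⟨d, hd⟩ := hG.isPrimitiveOp.exists_coeffDegreesLE
  refine ⟨d, fun Q hQ hord => ?_⟩
  have hQ0 := hQ.1.ne_zero
  rw [hG.eq_natDegree h] at hord
  obtain ⟨a, ha, hGa⟩ := exists_smul_of_mem_principal hG.isPrimitiveOp.ne_zero hQ0
    ((hG.isRightFactor_iff Q hQ0).1 hQ.2.1) hord.ge
  exact hd.of_smul hG.isPrimitiveOp hQ.1 ha hGa

theorem GovernsQuotients.isLocalQuasiSymQuotient (hG : GovernsQuotients M L G) {Q : DiffOp C}
    (hQ : IsPrimitiveOp Q) (hord : Q.natDegree = G.natDegree)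
    (h : IsRightFactor (symProd L Q) M) : IsLocalQuasiSymQuotient M L Q := by
  refine ⟨hQ, ?_, h⟩
  obtain ⟨a, ha, hGa⟩ := exists_smul_of_mem_principal hG.isPrimitiveOp.ne_zero hQ.ne_zero
    ((hG.isRightFactor_iff Q hQ.ne_zero).1 h) hord.ge
  rw [← hG.solutionSpace_eq, hGa]
  refine le_antisymm (solutionSpace_mono ?_) (solutionSpace_mono ?_)
  · rw [← principal_smul Q ha]
    exact (principal_smul Q ha) ▸ (principal Q).smul_mem a (self_mem_principal Q)
  · rw [principal_smul Q ha]
    exact self_mem_principal Q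

theorem GovernsQuotients.finite (hG : GovernsQuotients M L G) : Module.Finite C (solColon M L) :=
  Module.rank_lt_aleph0_iff.1 (hG.rank_eq ▸ Cardinal.natCast_lt_aleph0)

theorem GovernsQuotients.finrank_eq (hG : GovernsQuotients M L G) :
    Module.finrank C (solColon M L) = G.natDegree :=
  Module.finrank_eq_of_rank_eq hG.rank_eq

/-- The precision `k` is positive and separates the elements of the colon space. -/
def IsAdmissiblePrecision (M L : DiffOp C) (k : ℤ) : Prop :=
  1 ≤ k ∧ ∀ w ∈ solColon M L, w ≠ 0 → w.order ≤ k

/-- Positivity is needed here: doubling must not lower the precision. -/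
theorem IsAdmissiblePrecision.two_mul {k : ℤ} (h : IsAdmissiblePrecision M L k) :
    IsAdmissiblePrecision M L (2 * k) :=
  ⟨by have := h.1; omega, fun w hw h0 => (h.2 w hw h0).trans (by have := h.1; omega)⟩

theorem exists_basis_map {V : Type*} [AddCommGroup V] [Module C V] (W : Submodule C V)
    [Module.Finite C W] (T : V →ₗ[C] V) (hT : ∀ w ∈ W, T w = 0 → w = 0) {n : ℕ}
    (hn : Module.finrank C W = n) :
    ∃ b : Fin n → V, LinearIndependent C b ∧ Submodule.span C (Set.range b) = W.map T := by
  let b := Module.finBasisOfFinrankEq C W hn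
  have hinj : LinearMap.ker (T ∘ₗ W.subtype) = ⊥ :=
    LinearMap.ker_eq_bot'.2 fun w hw => Subtype.ext (hT w w.2 hw)
  refine ⟨T ∘ W.subtype ∘ b, b.linearIndependent.map' _ hinj, ?_⟩
  have h1 : Set.range (T ∘ W.subtype ∘ b) = (T ∘ₗ W.subtype) '' Set.range b := by
    rw [← Set.range_comp]; rfl
  rw [h1, Submodule.span_image, b.span_eq, Submodule.map_comp, Submodule.map_subtype_top]

/-- A colon space element with zero truncation would have order at least `k + 1`. So truncation is
injective, and the truncated space still has exactly `δ` basis elements. -/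
theorem GovernsQuotients.exists_colonSpaceBasis (hG : GovernsQuotients M L G) {δ : ℕ}
    (h : ColonSpaceDimension M L δ) {k : ℤ} (hk : IsAdmissiblePrecision M L k) :
    ∃ b : Fin δ → LaurentSeries C, ColonSpaceBasis M L k b := by
  have := hG.finite
  refine exists_basis_map (solColon M L) (truncate k) (fun w hw hw0 => ?_)
    (by rw [hG.finrank_eq, hG.eq_natDegree h])
  by_contra h0
  have h2 := isBigOX_sub_truncate k w
  rw [hw0, sub_zero] at h2
  have := h2.le_order h0
  have := hk.2 w hw h0
  omega

/-- The cut-off tails are `O(x^(k+1))` and `Q` lowers orders by at most `δ`, so the approximation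
passes from truncations to the true series. -/
theorem ColonSpaceBasis.isBigOX_act {k : ℤ} {δ : ℕ} {b : Fin δ → LaurentSeries C}
    (hb : ColonSpaceBasis M L k b) {Q : DiffOp C} (hQ : IsPrimitiveOp Q) (hδ : Q.natDegree ≤ δ)
    (h : ∀ j, IsBigOX (Q.act (b j)) (k - δ)) {w : LaurentSeries C} (hw : w ∈ solColon M L) :
    IsBigOX (Q.act w) (k - δ) := by
  have h1 : Submodule.span C (Set.range b) ≤ (bigOX C (k - δ)).comap (actLM Q) := by
    rw [Submodule.span_le]
    rintro _ ⟨j, rfl⟩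
    exact h j
  rw [hb.2] at h1
  have h2 : IsBigOX (Q.act (truncate k w)) (k - δ) := h1 (Submodule.mem_map_of_mem hw)
  have h3 := (hQ.isBigOX_act hδ (isBigOX_sub_truncate k w)).mono (show k - δ ≤ k + 1 - δ by omega)
  have h4 := h3.add h2
  rwa [← act_add_right, sub_add_cancel] at h4

/-- `G` kills the untruncated series, so on a truncation it returns only minus the image of the
tail. -/
theorem GovernsQuotients.isApproximant (hG : GovernsQuotients M L G) {k : ℤ} {δ : ℕ}
    (hδ : ColonSpaceDimension M L δ) {b : Fin δ → LaurentSeries C} (hb : ColonSpaceBasis M L k b)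
    {d : ℤ} (hd : CoeffDegreesLE G d) : IsApproximant b d k G := by
  have hle : G.natDegree ≤ δ := (hG.eq_natDegree hδ).ge
  refine ⟨hG.isPrimitiveOp, hle, hd, fun j => ?_⟩
  have h1 : b j ∈ (solColon M L).map (truncate k) := hb.2 ▸ Submodule.subset_span ⟨j, rfl⟩
  obtain ⟨w, hw, hwj⟩ := h1
  have hw0 : G.act w = 0 := by
    have : w ∈ solutionSpace G := hG.solutionSpace_eq ▸ hw
    exact this
  have h2 := hG.isPrimitiveOp.isBigOX_act hle (isBigOX_sub_truncate k w)
  rw [← actLM_apply, map_sub, actLM_apply, actLM_apply, hw0, zero_sub, hwj] at h2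
  intro n hn
  have := h2 n (by omega)
  rwa [HahnSeries.coeff_neg, neg_eq_zero] at this

theorem natCast_le_floor_div {δ d₀ : ℕ} {k : ℤ} (h : ((δ : ℤ) + 1) * (d₀ + 1) + δ ≤ k) :
    (d₀ : ℤ) ≤ ⌊((k - δ : ℤ) : ℚ) / ((δ + 1 : ℤ) : ℚ)⌋ := by
  have hpos : (0 : ℚ) < ((δ + 1 : ℤ) : ℚ) := by exact_mod_cast Nat.succ_pos δ
  rw [Int.le_floor, le_div_iff₀ hpos]
  have h1 : (d₀ : ℤ) * (δ + 1) ≤ k - δ := by nlinarith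
  exact_mod_cast h1

variable [CharZero C]

/-- At sufficiently high precision every approximant is a quotient. -/
theorem GovernsQuotients.exists_precision (hG : GovernsQuotients M L G) {δ : ℕ}
    (hδ : ColonSpaceDimension M L δ) (d₀ : ℕ) :
    ∃ K : ℤ, ∀ k, K ≤ k → ∀ (b : Fin δ → LaurentSeries C), ColonSpaceBasis M L k b →
      ∀ (d : ℤ) (Q : DiffOp C), d ≤ d₀ → IsApproximant b d k Q →
        Q.ord = δ ∧ IsRightFactor (symProd L Q) M := by
  have := hG.finite
  obtain ⟨K, hK⟩ := exists_forall_act_eq_zero (solColon M L) δ d₀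
  -- Approximants are controlled only up to order `k - δ`, hence the extra `δ`.
  refine ⟨K + δ, fun k hk b hb d Q hd ⟨hQ, hord, hdeg, happ⟩ => ?_⟩
  have hδG := hG.eq_natDegree hδ
  have hkill := hK Q hord (fun i => by
    obtain ⟨p, hp, hpd⟩ := hdeg i
    exact ⟨p, hp, hpd.trans hd⟩)
    (fun w hw => (hb.isBigOX_act hQ hord happ hw).mono (by omega))
  obtain ⟨R, S, hRS, hS⟩ := exists_mul_add G hG.isPrimitiveOp.ne_zero Q
  -- Both `Q` and `G` kill the colon space, so the remainder does too; a nonzero operator of order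
  -- below `δ` cannot kill a space of dimension `δ`.
  have hS0 : S = 0 := by
    by_contra hS0
    have hle : solColon M L ≤ solutionSpace S := by
      intro w hw
      have h1 : G.act w = 0 := by
        have : w ∈ solutionSpace G := hG.solutionSpace_eq ▸ hw
        exact this
      have h2 := hkill w hw
      rw [hRS, act_add, act_mul, h1, act_zero, zero_add] at h2
      exact h2
    have := finite_solutionSpace S hS0
    have h3 := (Submodule.finrank_mono hle).trans (finrank_solutionSpace_le S hS0)
    rw [hG.finrank_eq] at h3
    exact absurd (Polynomial.natDegree_lt_natDegree hS0 hS) (by omega)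
  have hQG : Q ∈ principal G := ⟨R, by rw [hRS, hS0, add_zero, mul_eq_opAct]⟩
  have hord' : Q.natDegree ≤ δ := hord
  have hge := natDegree_le_of_mem_principal hQ.ne_zero hG.isPrimitiveOp.ne_zero hQG
  obtain ⟨a, ha, hQa⟩ := exists_smul_of_mem_principal hQ.ne_zero hG.isPrimitiveOp.ne_zero hQG
    (by omega)
  refine ⟨le_antisymm hord (by rw [hδG]; exact hge), (hG.isRightFactor_iff Q hQ.ne_zero).2 ?_⟩
  rw [hQa, principal_smul G ha]
  exact self_mem_principal G

/-- The facts that hold at each position of the program. -/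
def Invariant (M L : DiffOp C) : State C → Prop
  | .start => True
  | .dimension δ => ColonSpaceDimension M L δ
  | .precision δ k => ColonSpaceDimension M L δ ∧ IsAdmissiblePrecision M L k
  | .loop δ d₀ k => ColonSpaceDimension M L δ ∧ BoundDegree M L δ d₀ ∧ IsAdmissiblePrecision M L k
  | .basis δ d₀ k h => ColonSpaceDimension M L δ ∧ BoundDegree M L δ d₀ ∧
      IsAdmissiblePrecision M L k ∧ ColonSpaceBasis M L k h
  | .candidate δ d₀ k Q => ColonSpaceDimension M L δ ∧ BoundDegree M L δ d₀ ∧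
      IsAdmissiblePrecision M L k ∧ ∃ h : Fin δ → LaurentSeries C, ColonSpaceBasis M L k h ∧
        ApproximantAnnihilator h (min (d₀ : ℤ) ⌊((k - δ : ℤ) : ℚ) / ((δ + 1 : ℤ) : ℚ)⌋) k Q
  | .returned res => ∃ Q, res = some Q ∧ IsLocalQuasiSymQuotient M L Q

omit [CharZero C] in
theorem isPrimitiveOp_one : IsPrimitiveOp (1 : DiffOp C) :=
  ⟨1, by rw [Polynomial.map_one], Polynomial.isPrimitive_one, by
    rw [Polynomial.leadingCoeff_one]; exact Polynomial.monic_one⟩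

theorem mem_principal_one (P : DiffOp C) : P ∈ principal (1 : DiffOp C) := by
  obtain ⟨R, S, h, hS⟩ := exists_mul_add 1 one_ne_zero P
  rw [Polynomial.degree_one, Nat.WithBot.lt_zero_iff, Polynomial.degree_eq_bot] at hS
  exact ⟨R, by rw [h, hS, add_zero, mul_eq_opAct]⟩

omit [CharZero C] in
theorem exists_ne_zero_mem_solColon {δ : ℕ} (h : ColonSpaceDimension M L δ) (hδ : 0 < δ) :
    ∃ w ∈ solColon M L, w ≠ 0 := by
  apply (Submodule.ne_bot_iff _).1
  intro hbot
  rw [ColonSpaceDimension, hbot, rank_bot] at h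
  exact hδ.ne (by exact_mod_cast h)

/-- All nonzero colon space elements have order between 0 and `k₀`. Since `δ > 0` such an element
exists, which gives `k₀ ≥ 0` and thus `k ≥ 1`. -/
theorem isAdmissiblePrecision_initial (hM : 0 < M.natDegree) (hL : 0 < L.natDegree)
    (hMr : IsRegularOp M) (hLr : IsRegularOp L) {δ z : ℕ} (h : ColonSpaceDimension M L δ)
    (hδ : 0 < δ) (hz : IsGreatest (indicialRoots (symProd M (symPow L (L.ord - 1)))) z) :
    IsAdmissiblePrecision M L ((z : ℤ) - (L.ord * (L.ord - 1) / 2 : ℕ) + 1) := by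
  have key : ∀ w ∈ solColon M L, w ≠ 0 →
      0 ≤ w.order ∧ w.order ≤ (z : ℤ) - (L.ord * (L.ord - 1) / 2 : ℕ) := by
    intro w hw h0
    obtain ⟨h1, y, hy, hyw⟩ := order_mem_indicialRoots hM hL hMr hLr hw h0
    have h2 : y ≤ z := hz.2 hy
    refine ⟨h1, ?_⟩
    simp only [DiffOp.ord]
    omega
  refine ⟨?_, fun w hw h0 => (key w hw h0).2.trans (by omega)⟩
  obtain ⟨w, hw, h0⟩ := exists_ne_zero_mem_solColon h hδ
  have := key w hw h0
  omega

theorem Invariant.step (hM : 0 < M.natDegree) (hL : 0 < L.natDegree) (hMr : IsRegularOp M)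
    (hLr : IsRegularOp L) (hG : GovernsQuotients M L G) {s t : State C} (hs : Invariant M L s)
    (h : Step M L s t) : Invariant M L t := by
  cases h with
  | dimension δ h => exact h
  | trivial =>
    refine ⟨1, rfl, hG.isLocalQuasiSymQuotient isPrimitiveOp_one ?_ ?_⟩
    · rw [Polynomial.natDegree_one]; exact hG.eq_natDegree hs
    · exact (hG.isRightFactor_iff 1 one_ne_zero).2 (mem_principal_one G)
  | precision δ z hδ hz => exact ⟨hs, isAdmissiblePrecision_initial hM hL hMr hLr hs hδ hz⟩
  | bound δ d₀ k h => exact ⟨hs.1, h, hs.2⟩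
  | basis δ d₀ k b h => exact ⟨hs.1, hs.2.1, hs.2.2, h⟩
  | approximant δ d₀ k b Q h => exact ⟨hs.1, hs.2.1, hs.2.2.1, b, hs.2.2.2, h⟩
  | returnNone δ d₀ k h =>
    obtain ⟨hδ, hd, -, b, hb, happ⟩ := hs
    -- At this precision the degree bound in force is `d₀`, so `G` is an admissible approximant and
    -- the empty answer is contradictory.
    rw [min_eq_left (natCast_le_floor_div h)] at happ
    exact absurd ⟨G, hG.isApproximant hδ hb
      (hd G hG.isGlobalQuasiSymQuotient (hG.eq_natDegree hδ).symm)⟩ happ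
  | returnSome δ d₀ k Q hord h =>
    obtain ⟨hδ, -, -, b, -, happ⟩ := hs
    exact ⟨Q, rfl, hG.isLocalQuasiSymQuotient happ.1 (hord.trans (hG.eq_natDegree hδ)) h⟩
  | doubleNone δ d₀ k h => exact ⟨hs.1, hs.2.1, hs.2.2.1.two_mul⟩
  | doubleSome δ d₀ k Q h => exact ⟨hs.1, hs.2.1, hs.2.2.1.two_mul⟩

theorem Invariant.exists_step (hM : 0 < M.natDegree) (hL : 0 < L.natDegree) (hMr : IsRegularOp M)
    (hLr : IsRegularOp L) (hG : GovernsQuotients M L G) {s : State C} (hs : Invariant M L s) :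
    (∃ res, s = .returned res) ∨ ∃ t, Step M L s t := by
  cases s with
  | start => exact Or.inr ⟨_, .dimension G.natDegree hG.rank_eq⟩
  | dimension δ =>
    right
    rcases Nat.eq_zero_or_pos δ with rfl | hδ
    · exact ⟨_, .trivial⟩
    obtain ⟨w, hw, h0⟩ := exists_ne_zero_mem_solColon hs hδ
    obtain ⟨-, y, hy, -⟩ := order_mem_indicialRoots hM hL hMr hLr hw h0
    obtain ⟨z, hz⟩ := exists_isGreatest_indicialRoots ⟨y, hy⟩
    exact ⟨_, .precision δ z hδ hz⟩
  | precision δ k =>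
    obtain ⟨d₀, hd⟩ := hG.exists_boundDegree hs.1
    exact Or.inr ⟨_, .bound δ d₀ k hd⟩
  | loop δ d₀ k =>
    obtain ⟨b, hb⟩ := hG.exists_colonSpaceBasis hs.1 hs.2.2
    exact Or.inr ⟨_, .basis δ d₀ k b hb⟩
  | basis δ d₀ k b =>
    right
    by_cases h : ∃ Q, IsApproximant b
        (min (d₀ : ℤ) ⌊((k - δ : ℤ) : ℚ) / ((δ + 1 : ℤ) : ℚ)⌋) k Q
    · obtain ⟨Q, hQ⟩ := h
      exact ⟨_, .approximant δ d₀ k b (some Q) hQ⟩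
    · exact ⟨_, .approximant δ d₀ k b none h⟩
  | candidate δ d₀ k Q =>
    right
    rcases Q with _ | Q
    · by_cases h : ((δ : ℤ) + 1) * (d₀ + 1) + δ ≤ k
      · exact ⟨_, .returnNone δ d₀ k h⟩
      · exact ⟨_, .doubleNone δ d₀ k h⟩
    · by_cases h : Q.ord = δ ∧ IsRightFactor (symProd L Q) M
      · exact ⟨_, .returnSome δ d₀ k Q h.1 h.2⟩
      · exact ⟨_, .doubleSome δ d₀ k Q h⟩
  | returned res => exact Or.inl ⟨res, rfl⟩

omit [CharZero C] in
theorem acc_returned (M L : DiffOp C) (res : Option (DiffOp C)) :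
    Acc (fun t s => Step M L s t) (.returned res) :=
  ⟨_, fun t h => by cases h⟩

/-- Beyond the bound `B` an approximant is always accepted and an empty result always stops the
loop. Below it, doubling a positive `k` decreases `B - k`. -/
theorem GovernsQuotients.acc_loop (hG : GovernsQuotients M L G) {δ d₀ : ℕ} {k : ℤ}
    (hδ : ColonSpaceDimension M L δ) (hk : 1 ≤ k) :
    Acc (fun t s => Step M L s t) (.loop δ d₀ k) := by
  obtain ⟨K, hK⟩ := hG.exists_precision hδ d₀
  set B := max K (((δ : ℤ) + 1) * (d₀ + 1) + δ) with hB
  induction hn : (B - k).toNat using Nat.strong_induction_on generalizing k with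
  | _ n ih =>
  refine ⟨_, fun t ht => ?_⟩
  cases ht with
  | basis _ _ _ b hb =>
  refine ⟨_, fun t ht => ?_⟩
  cases ht with
  | approximant _ _ _ _ Q hQ =>
  refine ⟨_, fun t ht => ?_⟩
  cases ht with
  | returnNone _ _ _ h => exact acc_returned M L _
  | returnSome _ _ _ Q h1 h2 => exact acc_returned M L _
  | doubleNone _ _ _ h =>
    have : k < B := lt_of_not_ge fun h' => h ((le_max_right _ _).trans h')
    exact ih _ (by omega) (by omega) rfl
  | doubleSome _ _ _ Q h =>
    have : k < B := lt_of_not_ge fun h' =>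
      h (hK k ((le_max_left _ _).trans h') b hb _ Q (min_le_left _ _) hQ)
    exact ih _ (by omega) (by omega) rfl

theorem GovernsQuotients.acc_start (hM : 0 < M.natDegree) (hL : 0 < L.natDegree)
    (hMr : IsRegularOp M) (hLr : IsRegularOp L) (hG : GovernsQuotients M L G) :
    Acc (fun t s => Step M L s t) .start := by
  refine ⟨_, fun t ht => ?_⟩
  cases ht with
  | dimension δ hδ =>
  refine ⟨_, fun t ht => ?_⟩
  cases ht with
  | trivial => exact acc_returned M L _
  | precision _ z hpos hz =>
  refine ⟨_, fun t ht => ?_⟩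
  cases ht with
  | bound _ d₀ _ hd =>
  exact hG.acc_loop hδ (isAdmissiblePrecision_initial hM hL hMr hLr hδ hpos hz).1

theorem Invariant.of_reachable (hM : 0 < M.natDegree) (hL : 0 < L.natDegree)
    (hMr : IsRegularOp M) (hLr : IsRegularOp L) (hG : GovernsQuotients M L G) {s : State C}
    (hs : Reachable M L s) : Invariant M L s := by
  unfold Reachable at hs
  induction hs with
  | refl => trivial
  | tail _ h ih => exact ih.step hM hL hMr hLr hG h

theorem not_exists_infinite_of_acc {α : Type*} {r : α → α → Prop} {a : α}
    (h : Acc (fun t s => r s t) a) : ¬ ∃ s : ℕ → α, s 0 = a ∧ ∀ n, r (s n) (s (n + 1)) := by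
  induction h with
  | intro a _ ih =>
    rintro ⟨s, rfl, hs⟩
    exact ih (s 1) (hs 0) ⟨fun n => s (n + 1), rfl, fun n => hs (n + 1)⟩

end Algorithm

end SymDiv

end

theorem mainTheorem2 {C : Type u} [Field C] [IsAlgClosed C] [CharZero C]
    (M L : SymDiv.DiffOp C) (hM : 0 < M.ord) (hL : 0 < L.ord)
    (hM0 : SymDiv.IsOrdinaryAtZero M) (hL0 : SymDiv.IsOrdinaryAtZero L) :
    (¬ ∃ s : ℕ → SymDiv.State C,
      s 0 = SymDiv.State.start ∧ ∀ n, SymDiv.Step M L (s n) (s (n + 1))) ∧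
    (∀ s : SymDiv.State C, SymDiv.Reachable M L s →
      (∃ res, s = SymDiv.State.returned res) ∨ ∃ t, SymDiv.Step M L s t) ∧
    (∀ Q : SymDiv.DiffOp C, SymDiv.Reachable M L (SymDiv.State.returned (some Q)) →
      SymDiv.IsLocalQuasiSymQuotient M L Q) ∧
    (∀ res : Option (SymDiv.DiffOp C), SymDiv.Reachable M L (SymDiv.State.returned res) →
      (res = none ↔ ¬ ∃ Q : SymDiv.DiffOp C, SymDiv.IsLocalQuasiSymQuotient M L Q)) := by
  obtain ⟨G, h1, h2, h3, h4⟩ :=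
    SymDiv.exists_quotient hM0.1 hL hM0.isRegularOp hL0.isRegularOp
  have hG : SymDiv.GovernsQuotients M L G := ⟨h1, h2, h3, h4⟩
  have hinv : ∀ s, SymDiv.Reachable M L s → SymDiv.Invariant M L s := fun s hs =>
    SymDiv.Invariant.of_reachable hM hL hM0.isRegularOp hL0.isRegularOp hG hs
  refine ⟨SymDiv.not_exists_infinite_of_acc
    (hG.acc_start hM hL hM0.isRegularOp hL0.isRegularOp), fun s hs =>
      (hinv s hs).exists_step hM hL hM0.isRegularOp hL0.isRegularOp hG, fun Q hQ => ?_,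
      fun res hres => ?_⟩
  · obtain ⟨Q', hQ', h⟩ := hinv _ hQ
    rw [Option.some.inj hQ']
    exact h
  · obtain ⟨Q, rfl, h⟩ := hinv _ hres
    -- Every returned answer is a quotient, so both sides of the equivalence are false.
    exact ⟨fun h' => absurd h' (by simp), fun h' => absurd ⟨Q, h⟩ h'⟩
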